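/- **Setting.** Let $\mathfrak H$ be a complex Hilbert space (inner product linear in the first argument) and $A\subset\mathfrak H\times\mathfrak H$ a closed symmetric linear relation with adjoint $A^*$. Let $\mathfrak H_0=\overline{\operatorname{dom}A}$ and let $P_{\mathfrak H_0}$ be the orthogonal projection onto it. Let $\mathfrak H_+=\operatorname{dom}A^*\oplus\operatorname{mul}A$ with norm $\|h+m\|_+^2=\|h\|^2+\|P_{\mathfrak H_0}h'\|^2+\|m\|^2$ for $(h,h')\in A^*$, $m\in\operatorname{mul}A$. Let $\mathfrak H_-$ be the space of bounded conjugate linear functionals on $\mathfrak H_+$ with duality $\langle\mathfrak f,h\rangle_{-,+}=\mathfrak f(h)$; then $\mathfrak H\subset\mathfrak H_-$ via $\langle f,h\rangle_{-,+}=(f,h)$. The symbol $\langle *\rangle$ denotes adjoints with respect to this duality. Put $$\mathbf A=\{(f,\mathfrak f')\in\mathfrak H\times\mathfrak H_-:\langle\mathfrak f',h\rangle_{-,+}=(f,h')\ \ \forall (h,h')\in A^*\},$$ $$A^{\langle*\rangle}=\{(f,\mathfrak f')\in\mathfrak H\times\mathfrak H_-:\langle\mathfrak f',h\rangle_{-,+}=(f,h')\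 \ \forall (h,h')\in A\}.$$ **Boundary triples.** Let $\Pi=(\mathbb C^p,\Gamma_0,\Gamma_1)$ be a boundary triple for $A^*$: $\Gamma_0,\Gamma_1:A^*\to\mathbb C^p$ are linear, $(f',g)-(f,g')=(\Gamma_0\hat g)^*\Gamma_1\hat f-(\Gamma_1\hat g)^*\Gamma_0\hat f$ for $\hat f=(f,f'),\hat g=(g,g')\in A^*$, and $\operatorname{col}(\Gamma_0,\Gamma_1):A^*\to\mathbb C^{2p}$ is onto. Let $A_0=\ker\Gamma_0$, which is selfadjoint, and $R^0_z=(A_0-z)^{-1}:\mathfrak H\to\mathfrak H_+$ for $z\in\rho(A_0)$. For $z\in\rho(A_0)$ the restriction of $\Gamma_0$ to $\{(f,zf)\in A^*\}$ is bijective onto $\mathbb C^p$; let $\hat\gamma(z)$ be its inverse, $\gamma(z):\mathbb C^p\to\mathfrak H_+$ the first component of $\hat\gamma(z)$, and $M(z)=\Gamma_1\hat\gamma(z)$. Put $\widetilde R^0_z=(R^0_{\bar z})^{\langle*\rangle}:\mathfrak H_-\to\mathfrak H$, $\ \mathbf R^0=\bigl(\tfrac12(R^0_i+R^0_{-i})\bigr)^{\langle*\rangle}$,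 and $\widehat R^0_z=\widetilde R^0_z-\mathbf R^0:\mathfrak H_-\to\mathfrak H_+$. The extended boundary triple $(\mathbb C^p,\widehat\Gamma_0,\widehat\Gamma_1)$ for $A^{\langle*\rangle}$ is the continuation of $\Gamma$ to $A^{\langle*\rangle}$ determined, with any $z_0\in\rho(A_0)$, by $$\widehat\Gamma_0\begin{bmatrix}\widetilde R^0_{z_0}\mathfrak f\\ \mathfrak f+z_0\widetilde R^0_{z_0}\mathfrak f\end{bmatrix}=0,\qquad \widehat\Gamma_1\begin{bmatrix}\widetilde R^0_{z_0}\mathfrak f\\ \mathfrak f+z_0\widetilde R^0_{z_0}\mathfrak f\end{bmatrix}=\gamma(\bar z_0)^{\langle*\rangle}\mathfrak f\quad(\mathfrak f\in\mathfrak H_-),\qquad \widehat\Gamma_j\hat\gamma(z_0)=\Gamma_j\hat\gamma(z_0)\quad(j=0,1).$$ **Gauge.** Let $\mathfrak L\subset\mathfrak H_-$ be a $p$-dimensional subspace and $L:\mathbb C^p\to\mathfrak L$ an isomorphism. Let $\rho(A,\mathfrak L)$ be the set of points $z$ of regular type of $A$ with $\mathfrak H_-=\operatorname{ran}(\mathbf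 A-z)\dotplus\mathfrak L$, and assume $\rho(A,\mathfrak L)\neq\emptyset$. For $z\in\rho(A,\mathfrak L)$ let $\Pi^z_{\mathfrak L}$ be the projection of $\mathfrak H_-$ onto $\mathfrak L$ parallel to $\operatorname{ran}(\mathbf A-z)$ and put $$\mathcal P(z)=L^{-1}\Pi^z_{\mathfrak L}:\mathfrak H_-\to\mathbb C^p,\qquad \mathcal Q(z)=L^{\langle*\rangle}\bigl(\mathbf R_z-\widehat{\mathbf R}_z\Pi^z_{\mathfrak L}\bigr):\mathfrak H\to\mathbb C^p.$$ Here $\mathbf R_z=P_{\mathfrak H}(\widetilde A-z)^{-1}|_{\mathfrak H}$ is a generalized resolvent of $A$, where $\widetilde A$ is a selfadjoint extension of $A$ in a possibly larger Hilbert space with $z\in\rho(\widetilde A)$, and $\widehat{\mathbf R}_z=(\mathbf R_{\bar z})^{\langle*\rangle}-\mathbf R^0$; such an extension exists, and $\mathcal Q(z)$ does not depend on its choice. Put $\mathcal Q(z)^{\langle*\rangle}=\mathcal Q(z)^*$, $$\mathcal G(z)=\begin{bmatrix}-\mathcal Q(z)\\ \mathcal P(z)\end{bmatrix},\qquad \widehat{\mathcal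 P}(z)^{\langle*\rangle}u=\begin{bmatrix}\mathcal P(z)^{\langle*\rangle}u\\ \bar z\,\mathcal P(z)^{\langle*\rangle}u\end{bmatrix},\qquad \widehat{\mathcal Q}(z)^{\langle*\rangle}u=\begin{bmatrix}\mathcal Q(z)^{\langle*\rangle}u\\ \bar z\,\mathcal Q(z)^{\langle*\rangle}u+Lu\end{bmatrix}$$ (the last two vectors belong to $A^{\langle*\rangle}$ for every $u\in\mathbb C^p$), and, for $z\in\rho(A,\mathfrak L)$, $$\widehat W(z)=\begin{bmatrix}-\widehat\Gamma_0\widehat{\mathcal Q}(z)^{\langle*\rangle}&\widehat\Gamma_0\widehat{\mathcal P}(z)^{\langle*\rangle}\\-\widehat\Gamma_1\widehat{\mathcal Q}(z)^{\langle*\rangle}&\widehat\Gamma_1\widehat{\mathcal P}(z)^{\langle*\rangle}\end{bmatrix}^*,\qquad J_p=\begin{bmatrix}0&-iI_p\\ iI_p&0\end{bmatrix}.$$ **Theorem 4.8.** (i) For all $z,\zeta\in\rho(A,\mathfrak L)$ with $z\ne\bar\zeta$, $$\frac{J_p-\widehat W(z)J_p\widehat W(\zeta)^*}{-i(z-\bar\zeta)}=\mathcal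 G(z)\,\mathcal G(\zeta)^{\langle*\rangle},$$ and $J_p-\widehat W(z)J_p\widehat W(\zeta)^*=-i(z-\bar\zeta)\,\mathcal G(z)\mathcal G(\zeta)^{\langle*\rangle}$ for all $z,\zeta\in\rho(A,\mathfrak L)$, including $z=\bar\zeta$. (ii) If $\rho_s(A,\mathfrak L):=\rho(A,\mathfrak L)\cap\overline{\rho(A,\mathfrak L)}$ (the bar denotes complex conjugation) is nonempty, then $\widehat W(z)$ is invertible for every $z\in\rho_s(A,\mathfrak L)$. For every $z\in\rho_s(A,\mathfrak L)\cap\rho(A_0)$ the matrix $\mathfrak a_{12}(z)$ is invertible and $\widehat W(z)$ coincides with the right $\Pi\mathfrak L$-resolvent matrix $$W_{\Pi\mathfrak L}(z)=\begin{bmatrix}\mathfrak a_{22}(z)\mathfrak a_{12}(z)^{-1}&\mathfrak a_{22}(z)\mathfrak a_{12}(z)^{-1}\mathfrak a_{11}(z)-\mathfrak a_{21}(z)\\ \mathfrak a_{12}(z)^{-1}&\mathfrak a_{12}(z)^{-1}\mathfrak a_{11}(z)\end{bmatrix},$$ where $$\mathfrak a_{11}(z)=M(z),\qquad \mathfrak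 a_{12}(z)=\gamma(\bar z)^{\langle*\rangle}L,\qquad \mathfrak a_{21}(z)=L^{\langle*\rangle}\gamma(z),\qquad \mathfrak a_{22}(z)=L^{\langle*\rangle}\widehat R^0_zL.$$ -/

import Mathlib

open scoped ComplexConjugate

noncomputable section

namespace LResolvent

universe u

section Relations

variable {K : Type*} [NormedAddCommGroup K] [InnerProductSpace ℂ K]

/-- The domain of a linear relation. -/
def relDom (T : Submodule ℂ (K × K)) : Submodule ℂ K := T.map (LinearMap.fst ℂ K K)

/-- The range of a linear relation. -/
def relRan (T : Submodule ℂ (K × K)) : Submodule ℂ K := T.map (LinearMap.snd ℂ K K)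

/-- The kernel `{f | (f, 0) ∈ T}` of a linear relation. -/
def relKer (T : Submodule ℂ (K × K)) : Submodule ℂ K := T.comap (LinearMap.inl ℂ K K)

/-- The multivalued part `{g | (0, g) ∈ T}` of a linear relation. -/
def relMul (T : Submodule ℂ (K × K)) : Submodule ℂ K := T.comap (LinearMap.inr ℂ K K)

/-- The relation `T - z I = {(f, g - z f) | (f, g) ∈ T}`. -/
def relShift (T : Submodule ℂ (K × K)) (z : ℂ) : Submodule ℂ (K × K) :=
  T.map ((LinearMap.fst ℂ K K).prod (LinearMap.snd ℂ K K - z • LinearMap.fst ℂ K K))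

/-- The set `ρ(T)` of regular points. -/
def resolventPoints (T : Submodule ℂ (K × K)) : Set ℂ :=
  {z | relKer (relShift T z) = ⊥ ∧ relRan (relShift T z) = ⊤}

/-- The set of points of regular type. -/
def regularTypePoints (T : Submodule ℂ (K × K)) : Set ℂ :=
  {z | relKer (relShift T z) = ⊥ ∧ IsClosed (relRan (relShift T z) : Set K)}

theorem mem_relDom {T : Submodule ℂ (K × K)} {f : K} : f ∈ relDom T ↔ ∃ g, (f, g) ∈ T := by
  simp [relDom]

theorem mem_relMul {T : Submodule ℂ (K × K)} {g : K} : g ∈ relMul T ↔ (0, g) ∈ T := by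
  simp [relMul]

theorem mem_relKer_shift {T : Submodule ℂ (K × K)} {z : ℂ} {f : K} :
    f ∈ relKer (relShift T z) ↔ (f, z • f) ∈ T := by
  simp only [relKer, relShift, Submodule.mem_comap, Submodule.mem_map, Prod.exists]
  constructor
  · rintro ⟨a, b, hab, h⟩
    simp only [LinearMap.prod_apply, LinearMap.inl_apply, Function.prod_apply, Prod.mk.injEq,
      LinearMap.fst_apply, LinearMap.sub_apply, LinearMap.snd_apply, LinearMap.smul_apply] at h
    obtain ⟨rfl, h2⟩ := h
    rwa [← sub_eq_zero.mp h2]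
  · intro h
    exact ⟨f, z • f, h, by simp⟩

theorem mem_relRan_shift {T : Submodule ℂ (K × K)} {z : ℂ} {g : K} :
    g ∈ relRan (relShift T z) ↔ ∃ f f', (f, f') ∈ T ∧ f' - z • f = g := by
  simp [relRan, relShift]

theorem mem_adjoint {T : Submodule ℂ (K × K)} {f f' : K} :
    (f, f') ∈ T.adjoint ↔ ∀ h h', (h, h') ∈ T → inner ℂ h' f = inner ℂ h f' := by
  simp [sub_eq_zero]

theorem isClosed_adjoint (T : Submodule ℂ (K × K)) : IsClosed (T.adjoint : Set (K × K)) := by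
  have : (T.adjoint : Set (K × K)) =
      ⋂ (h : K) (h' : K) (_ : (h, h') ∈ T), {x : K × K | inner ℂ h' x.1 = inner ℂ h x.2} := by
    ext ⟨f, f'⟩
    simp only [SetLike.mem_coe, mem_adjoint, Set.mem_iInter, Set.mem_ofPred_eq]
  rw [this]
  refine isClosed_iInter fun h => isClosed_iInter fun h' => isClosed_iInter fun _ => ?_
  exact isClosed_eq (by fun_prop) (by fun_prop)

/-- The map `(f, f') ↦ f' - z f` on a linear relation. -/
def shiftMap (T : Submodule ℂ (K × K)) (z : ℂ) : T →L[ℂ] K :=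
  (ContinuousLinearMap.snd ℂ K K - z • ContinuousLinearMap.fst ℂ K K) ∘L T.subtypeL

@[simp] theorem shiftMap_apply (T : Submodule ℂ (K × K)) (z : ℂ) (x : T) :
    shiftMap T z x = x.1.2 - z • x.1.1 := by simp [shiftMap]

theorem shiftMap_ker {T : Submodule ℂ (K × K)} {z : ℂ} (hz : relKer (relShift T z) = ⊥) :
    (shiftMap T z).ker = ⊥ := by
  rw [eq_bot_iff]
  rintro ⟨⟨f, f'⟩, hf⟩ h
  have h1 : f' = z • f := by simpa [sub_eq_zero] using h
  subst h1
  have h0 : f = 0 := by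
    have := mem_relKer_shift.mpr hf
    rwa [hz, Submodule.mem_bot] at this
  subst h0
  simp

theorem shiftMap_range (T : Submodule ℂ (K × K)) (z : ℂ) :
    (shiftMap T z).range = relRan (relShift T z) := by
  ext g
  simp [mem_relRan_shift]

theorem selfadjoint_bound {T : Submodule ℂ (K × K)} (hT : T ≤ T.adjoint) {z : ℂ} {f f' : K}
    (h : (f, f') ∈ T) : |z.im| * ‖f‖ ≤ ‖f' - z • f‖ := by
  have h1 : inner ℂ f' f = inner ℂ f f' := mem_adjoint.mp (hT h) _ _ h
  have h2 : (inner ℂ f f').im = 0 := by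
    have := congrArg Complex.im h1
    rw [← inner_conj_symm f' f, Complex.conj_im] at this
    linarith
  have h3 : (inner ℂ f (f' - z • f)).im = - (z.im * ‖f‖ ^ 2) := by
    rw [inner_sub_right, inner_smul_right, inner_self_eq_norm_sq_to_K, Complex.sub_im, h2]
    norm_cast
    simp [Complex.mul_im, -Complex.ofReal_pow]
  have h4 : |z.im| * ‖f‖ ^ 2 ≤ ‖f‖ * ‖f' - z • f‖ := by
    calc |z.im| * ‖f‖ ^ 2 = |(inner ℂ f (f' - z • f)).im| := by
          rw [h3, abs_neg, abs_mul, abs_of_nonneg (sq_nonneg ‖f‖)]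
      _ ≤ ‖inner ℂ f (f' - z • f)‖ := Complex.abs_im_le_norm _
      _ ≤ _ := norm_inner_le_norm _ _
  rcases (norm_nonneg f).eq_or_lt with h0 | h0
  · rw [← h0]; simp
  · nlinarith

variable [CompleteSpace K]

/-- The resolvent operator `(T - z I)⁻¹` of a closed relation at a regular point: it sends `g` to
the first component `f` of the unique `(f, f') ∈ T` with `f' - z f = g`. -/
def relResolvent (T : Submodule ℂ (K × K)) (hT : IsClosed (T : Set (K × K))) (z : ℂ)
    (hz : z ∈ resolventPoints T) : K →L[ℂ] K :=
  haveI : CompleteSpace T := hT.completeSpace_coe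
  (ContinuousLinearMap.fst ℂ K K) ∘L T.subtypeL ∘L
    ((ContinuousLinearEquiv.ofBijective (shiftMap T z) (shiftMap_ker hz.1)
      ((shiftMap_range T z).trans hz.2)).symm : K →L[ℂ] T)

theorem relResolvent_mem {T : Submodule ℂ (K × K)} (hT : IsClosed (T : Set (K × K))) {z : ℂ}
    (hz : z ∈ resolventPoints T) (g : K) :
    (relResolvent T hT z hz g, g + z • relResolvent T hT z hz g) ∈ T := by
  have : CompleteSpace T := hT.completeSpace_coe
  set x : T := (ContinuousLinearEquiv.ofBijective (shiftMap T z) (shiftMap_ker hz.1)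
      ((shiftMap_range T z).trans hz.2)).symm g with hx
  have h1 : x.1.2 - z • x.1.1 = g := by
    rw [← shiftMap_apply]
    exact (ContinuousLinearEquiv.ofBijective (shiftMap T z) (shiftMap_ker hz.1)
      ((shiftMap_range T z).trans hz.2)).apply_symm_apply g
  have h2 : relResolvent T hT z hz g = x.1.1 := rfl
  rw [h2, ← h1, sub_add_cancel]
  exact x.2

theorem relResolvent_apply {T : Submodule ℂ (K × K)} (hT : IsClosed (T : Set (K × K))) {z : ℂ}
    (hz : z ∈ resolventPoints T) {f f' : K} (h : (f, f') ∈ T) :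
    relResolvent T hT z hz (f' - z • f) = f := by
  have h1 := T.sub_mem (relResolvent_mem hT hz (f' - z • f)) h
  set r := relResolvent T hT z hz (f' - z • f)
  have h2 : r - f ∈ relKer (relShift T z) := by
    rw [mem_relKer_shift]
    convert h1 using 1
    ext
    · simp
    · simp only [Prod.snd_sub, smul_sub]; abel
  rw [hz.1, Submodule.mem_bot, sub_eq_zero] at h2
  exact h2

/-- Non-real points are regular points of a selfadjoint relation. -/
theorem mem_resolventPoints_of_im_ne_zero {T : Submodule ℂ (K × K)} (hT : T.adjoint = T) {z : ℂ}
    (hz : z.im ≠ 0) : z ∈ resolventPoints T := by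
  have hcl : IsClosed (T : Set (K × K)) := by rw [← hT]; exact isClosed_adjoint T
  have : CompleteSpace T := hcl.completeSpace_coe
  have hpos : 0 < |z.im| := abs_pos.mpr hz
  have hbd : ∀ x : T, ‖x‖ ≤ (1 + (‖z‖ + 1) / |z.im|) * ‖shiftMap T z x‖ := by
    rintro ⟨⟨f, f'⟩, hf⟩
    have h1 := selfadjoint_bound hT.ge hf (z := z)
    have h2 : ‖f‖ ≤ ‖f' - z • f‖ / |z.im| := by
      rw [le_div_iff₀ hpos]; linarith
    have h3 : ‖f'‖ ≤ ‖f' - z • f‖ + ‖z‖ * ‖f‖ := by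
      calc ‖f'‖ = ‖(f' - z • f) + z • f‖ := by simp
        _ ≤ _ := by rw [← norm_smul]; exact norm_add_le _ _
    have h5 : (0 : ℝ) ≤ ‖f' - z • f‖ / |z.im| := by positivity
    have h6 : ‖z‖ * ‖f‖ ≤ ‖z‖ * (‖f' - z • f‖ / |z.im|) :=
      mul_le_mul_of_nonneg_left h2 (norm_nonneg z)
    have h7 : (1 + (‖z‖ + 1) / |z.im|) * ‖f' - z • f‖ =
        ‖f' - z • f‖ + ‖z‖ * (‖f' - z • f‖ / |z.im|) + ‖f' - z • f‖ / |z.im| := by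
      field_simp; ring
    have h8 : (0 : ℝ) ≤ ‖z‖ * (‖f' - z • f‖ / |z.im|) := by positivity
    rw [shiftMap_apply]
    simp only [Submodule.coe_norm, Prod.norm_def]
    rw [h7]
    refine max_le ?_ ?_
    · have := norm_nonneg (f' - z • f); linarith
    · linarith
  constructor
  · rw [eq_bot_iff]
    intro f hf
    have h1 := selfadjoint_bound hT.ge (mem_relKer_shift.mp hf) (z := z)
    rw [sub_self, norm_zero] at h1
    have : ‖f‖ ≤ 0 := by nlinarith
    simpa using this
  · have hclr : IsClosed ((shiftMap T z).range : Set K) := by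
      have ha : AntilipschitzWith ⟨1 + (‖z‖ + 1) / |z.im|, by positivity⟩ (shiftMap T z) :=
        AddMonoidHomClass.antilipschitz_of_bound (shiftMap T z) hbd
      have := ha.isClosed_range (shiftMap T z).uniformContinuous
      rw [LinearMap.coe_range]
      exact this
    rw [← shiftMap_range]
    have : CompleteSpace (shiftMap T z).range := hclr.completeSpace_coe
    rw [← Submodule.orthogonal_eq_bot_iff, eq_bot_iff]
    intro g hg
    have h1 : (g, conj z • g) ∈ T := by
      rw [← hT, mem_adjoint]
      intro h h' hh
      have h2 := (Submodule.mem_orthogonal _ _).mp hg (h' - z • h) ⟨⟨(h, h'), hh⟩, by simp⟩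
      rw [inner_sub_left, inner_smul_left, sub_eq_zero] at h2
      rw [h2, inner_smul_right]
    have h3 := selfadjoint_bound hT.ge h1 (z := conj z)
    rw [sub_self, norm_zero, Complex.conj_im, abs_neg] at h3
    have : ‖g‖ ≤ 0 := by nlinarith
    simpa using this

theorem conj_mem_resolventPoints {T : Submodule ℂ (K × K)} (hT : T.adjoint = T) {z : ℂ}
    (hz : z ∈ resolventPoints T) : conj z ∈ resolventPoints T := by
  by_cases h : z.im = 0
  · rwa [Complex.conj_eq_iff_im.mpr h]
  · exact mem_resolventPoints_of_im_ne_zero hT (by simpa using h)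

end Relations

section AntiDual

variable (E : Type*) [NormedAddCommGroup E] [InnerProductSpace ℂ E]

/-- The space of bounded conjugate linear functionals on `E`, with the functional norm. -/
def AntiDual : Type _ := E →L⋆[ℂ] ℂ

namespace AntiDual

instance : NormedAddCommGroup (AntiDual E) := inferInstanceAs (NormedAddCommGroup (E →L⋆[ℂ] ℂ))

instance : NormedSpace ℂ (AntiDual E) := inferInstanceAs (NormedSpace ℂ (E →L⋆[ℂ] ℂ))

instance : CompleteSpace (AntiDual E) := inferInstanceAs (CompleteSpace (E →L⋆[ℂ] ℂ))

instance : FunLike (AntiDual E) E ℂ := inferInstanceAs (FunLike (E →L⋆[ℂ] ℂ) E ℂ)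

instance : ContinuousSemilinearMapClass (AntiDual E) (starRingEnd ℂ) E ℂ :=
  inferInstanceAs (ContinuousSemilinearMapClass (E →L⋆[ℂ] ℂ) (starRingEnd ℂ) E ℂ)

variable {E}

@[simp] theorem zero_apply (h : E) : (0 : AntiDual E) h = 0 := rfl

@[simp] theorem add_apply (φ ψ : AntiDual E) (h : E) : (φ + ψ) h = φ h + ψ h := rfl

@[simp] theorem sub_apply (φ ψ : AntiDual E) (h : E) : (φ - ψ) h = φ h - ψ h := rfl

@[simp] theorem smul_apply (c : ℂ) (φ : AntiDual E) (h : E) : (c • φ) h = c * φ h := rfl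

theorem continuous_eval (h : E) : Continuous fun φ : AntiDual E => φ h :=
  (ContinuousLinearMap.apply' ℂ (starRingEnd ℂ) h : (E →L⋆[ℂ] ℂ) →L[ℂ] ℂ).continuous

end AntiDual

/-- The vector `f` as the bounded conjugate linear functional `h ↦ (f, h)`. -/
def toAntiDual : E →L[ℂ] AntiDual E where
  toFun f := (innerSL ℂ (E := E)).flip f
  map_add' f g := map_add ((innerSL ℂ (E := E)).flip) f g
  map_smul' c f := map_smul ((innerSL ℂ (E := E)).flip) c f
  cont := ((innerSL ℂ (E := E)).flip).continuous

@[simp] theorem toAntiDual_apply (f h : E) : toAntiDual E f h = inner ℂ h f := rfl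

theorem toAntiDual_bijective [CompleteSpace E] : Function.Bijective (toAntiDual E) := by
  constructor
  · intro f g h
    refine ext_inner_left ℂ fun v => ?_
    exact congrArg (fun φ : AntiDual E => φ v) h
  · intro φ
    let ψ : StrongDual ℂ E :=
      { toFun := fun h => conj (φ h)
        map_add' := by intros; simp
        map_smul' := by intro c x; rw [map_smulₛₗ]; simp
        cont := Complex.continuous_conj.comp (map_continuous φ) }
    refine ⟨(InnerProductSpace.toDual ℂ E).symm ψ, ?_⟩
    apply DFunLike.ext
    intro h
    rw [toAntiDual_apply, ← inner_conj_symm, InnerProductSpace.toDual_symm_apply]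
    exact Complex.conj_conj _

/-- The Riesz identification of a Hilbert space with its conjugate dual. -/
def antiRiesz [CompleteSpace E] : E ≃L[ℂ] AntiDual E :=
  ContinuousLinearEquiv.ofBijective (toAntiDual E)
    (LinearMap.ker_eq_bot.mpr (toAntiDual_bijective E).1)
    (LinearMap.range_eq_top.mpr (toAntiDual_bijective E).2)

end AntiDual

section Rigging

/-- A closed symmetric linear relation in the Hilbert space `H`. -/
structure ClosedSymmetricRelation (H : Type*) [NormedAddCommGroup H] [InnerProductSpace ℂ H] where
  /-- the relation, a subspace of `H × H` -/
  rel : Submodule ℂ (H × H)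
  isClosed : IsClosed (rel : Set (H × H))
  symmetric : rel ≤ rel.adjoint

variable {H : Type*} [NormedAddCommGroup H] [InnerProductSpace ℂ H] [CompleteSpace H]

/-- The space `H₀`, the closure of `dom A` in `H`. -/
abbrev domClosure (A : ClosedSymmetricRelation H) : Submodule ℂ H :=
  (relDom A.rel).topologicalClosure

instance (A : ClosedSymmetricRelation H) : CompleteSpace (domClosure A) :=
  (Submodule.isClosed_topologicalClosure _).completeSpace_coe

/-- The orthogonal projection `P_{H₀}` in `H`. -/
def projDom (A : ClosedSymmetricRelation H) : H →L[ℂ] H := (domClosure A).starProjection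

theorem projDom_sub_mem (A : ClosedSymmetricRelation H) (f' : H) :
    ((0 : H), f' - projDom A f') ∈ A.rel.adjoint := by
  rw [mem_adjoint]
  intro h h' hh
  rw [inner_zero_right]
  have h1 : h ∈ domClosure A :=
    Submodule.le_topologicalClosure _ (mem_relDom.mpr ⟨h', hh⟩)
  have h2 := Submodule.sub_starProjection_mem_orthogonal (K := domClosure A) f'
  exact ((Submodule.mem_orthogonal _ _).mp h2 h h1).symm

theorem projDom_of_zero_mem (A : ClosedSymmetricRelation H) {g : H}
    (hg : ((0 : H), g) ∈ A.rel.adjoint) : projDom A g = 0 := by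
  have h1 : g ∈ (relDom A.rel)ᗮ := by
    rw [Submodule.mem_orthogonal]
    intro h hh
    obtain ⟨h', hh'⟩ := mem_relDom.mp hh
    have := mem_adjoint.mp hg h h' hh'
    rw [inner_zero_right] at this
    exact this.symm
  rw [projDom, Submodule.starProjection_apply_eq_zero_iff, Submodule.orthogonal_closure]
  exact h1

theorem projDom_mem_adjoint (A : ClosedSymmetricRelation H) {f f' : H}
    (h : (f, f') ∈ A.rel.adjoint) : (f, projDom A f') ∈ A.rel.adjoint := by
  have := A.rel.adjoint.sub_mem h (projDom_sub_mem A f')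
  simpa using this

/-- The Hilbert space `H₊ = dom A* ⊕ mul A`. A vector `h = h₀ + m` with `(h₀, h') ∈ A*` and
`m ∈ mul A` is recorded as the pair `(h, P_{H₀} h')`; the second entry is determined by `h`
(see `plusToH_injective`), and the inherited norm is
`‖h‖₊² = ‖h₀‖² + ‖P_{H₀} h'‖² + ‖m‖²`. -/
def plusGraph (A : ClosedSymmetricRelation H) : Submodule ℂ (WithLp 2 (H × H)) where
  carrier := {x | ∃ h₀ h' m : H, (h₀, h') ∈ A.rel.adjoint ∧ m ∈ relMul A.rel ∧
    x.fst = h₀ + m ∧ x.snd = projDom A h'}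
  zero_mem' := ⟨0, 0, 0, Submodule.zero_mem _, Submodule.zero_mem _, by simp, by simp⟩
  add_mem' := by
    rintro x y ⟨a, a', m, h1, h2, h3, h4⟩ ⟨b, b', n, k1, k2, k3, k4⟩
    refine ⟨a + b, a' + b', m + n, Submodule.add_mem _ h1 k1, Submodule.add_mem _ h2 k2, ?_, ?_⟩
    · rw [WithLp.add_fst, h3, k3]; abel
    · rw [WithLp.add_snd, h4, k4, map_add]
  smul_mem' := by
    rintro c x ⟨a, a', m, h1, h2, h3, h4⟩
    refine ⟨c • a, c • a', c • m, Submodule.smul_mem _ c h1, Submodule.smul_mem _ c h2, ?_, ?_⟩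
    · rw [WithLp.smul_fst, h3, smul_add]
    · rw [WithLp.smul_snd, h4, map_smul]

/-- The positive space `H₊` of the rigging. -/
abbrev HPlus (A : ClosedSymmetricRelation H) : Type _ := plusGraph A

/-- The embedding `H₊ ⊂ H`. -/
def plusToH (A : ClosedSymmetricRelation H) : HPlus A →L[ℂ] H :=
  WithLp.fstL 2 ℂ H H ∘L (plusGraph A).subtypeL

@[simp] theorem plusToH_apply (A : ClosedSymmetricRelation H) (x : HPlus A) :
    plusToH A x = x.1.fst := rfl

theorem inner_mul_dom (A : ClosedSymmetricRelation H) {h₀ h' m : H}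
    (h : (h₀, h') ∈ A.rel.adjoint) (hm : m ∈ relMul A.rel) : inner ℂ m h₀ = 0 := by
  have := mem_adjoint.mp h 0 m (mem_relMul.mp hm)
  rwa [inner_zero_left] at this

theorem plusToH_injective (A : ClosedSymmetricRelation H) :
    Function.Injective (plusToH A) := by
  rw [injective_iff_map_eq_zero]
  rintro ⟨x, h₀, h', m, h1, h2, h3, h4⟩ hx
  have hx1 : h₀ + m = 0 := by rw [← h3]; exact hx
  have hm : m = 0 := by
    have e1 := inner_mul_dom A h1 h2
    have e2 : inner ℂ m (h₀ + m) = 0 := by rw [hx1, inner_zero_right]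
    rw [inner_add_right, e1, zero_add] at e2
    exact inner_self_eq_zero.mp e2
  have h0 : h₀ = 0 := by simpa [hm] using hx1
  subst h0
  have e3 := projDom_of_zero_mem A h1
  have : x = 0 := by
    apply (WithLp.equiv 2 (H × H)).injective
    refine Prod.ext ?_ ?_
    · show x.fst = 0
      rw [h3, hm, add_zero]
    · show x.snd = 0
      rw [h4, e3]
  exact Subtype.ext this

theorem isClosed_relMul (A : ClosedSymmetricRelation H) : IsClosed (relMul A.rel : Set H) := by
  have : (relMul A.rel : Set H) = (fun g : H => ((0 : H), g)) ⁻¹' (A.rel : Set (H × H)) := by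
    ext g; simp [mem_relMul]
  rw [this]
  exact A.isClosed.preimage (by fun_prop)

theorem isClosed_plusGraph (A : ClosedSymmetricRelation H) :
    IsClosed (plusGraph A : Set (WithLp 2 (H × H))) := by
  haveI : CompleteSpace (relMul A.rel) := (isClosed_relMul A).completeSpace_coe
  have key : (plusGraph A : Set (WithLp 2 (H × H))) =
      {x | (x.fst - (relMul A.rel).starProjection x.fst, x.snd) ∈ A.rel.adjoint} ∩
        {x | projDom A x.snd = x.snd} := by
    ext x
    constructor
    · rintro ⟨h₀, h', m, h1, h2, h3, h4⟩
      have e0 : (relMul A.rel).starProjection h₀ = 0 := by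
        rw [Submodule.starProjection_apply_eq_zero_iff, Submodule.mem_orthogonal]
        intro u hu
        exact inner_mul_dom A h1 hu
      have e1 : (relMul A.rel).starProjection m = m :=
        Submodule.starProjection_eq_self_iff.mpr h2
      refine ⟨?_, ?_⟩
      · show (x.fst - (relMul A.rel).starProjection x.fst, x.snd) ∈ A.rel.adjoint
        rw [h3, h4, map_add, e0, e1, zero_add, add_sub_cancel_right]
        exact projDom_mem_adjoint A h1
      · show projDom A x.snd = x.snd
        rw [h4]
        exact Submodule.starProjection_eq_self_iff.mpr (Submodule.starProjection_apply_mem _ _)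
    · rintro ⟨h1, h2⟩
      exact ⟨_, _, (relMul A.rel).starProjection x.fst, h1, Submodule.starProjection_apply_mem _ _,
        by simp, h2.symm⟩
  rw [key]
  refine IsClosed.inter ?_ ?_
  · have hc : Continuous fun x : WithLp 2 (H × H) =>
        (x.fst - (relMul A.rel).starProjection x.fst, x.snd) := by fun_prop
    exact (isClosed_adjoint A.rel).preimage hc
  · exact isClosed_eq (by fun_prop) (by fun_prop)

instance (A : ClosedSymmetricRelation H) : CompleteSpace (HPlus A) :=
  (isClosed_plusGraph A).completeSpace_coe

/-- The lift of `dom A*` to `H₊`, as a bounded map `(f, f') ↦ f` from `A*` to `H₊`. -/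
def adjointToPlus (A : ClosedSymmetricRelation H) : A.rel.adjoint →L[ℂ] HPlus A :=
  ((WithLp.prodContinuousLinearEquiv 2 ℂ H H).symm.toContinuousLinearMap ∘L
    ((ContinuousLinearMap.fst ℂ H H).prod (projDom A ∘L ContinuousLinearMap.snd ℂ H H)) ∘L
      A.rel.adjoint.subtypeL).codRestrict (plusGraph A)
    fun x => ⟨x.1.1, x.1.2, 0, x.2, Submodule.zero_mem _, by simp, by simp⟩

@[simp] theorem plusToH_adjointToPlus (A : ClosedSymmetricRelation H) (x : A.rel.adjoint) :
    plusToH A (adjointToPlus A x) = x.1.1 := rfl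

/-- The negative space `H₋` of the rigging: the bounded conjugate linear functionals on `H₊`.
The duality is `⟨𝔣, h⟩₋₊ = 𝔣 h`. -/
abbrev HMinus (A : ClosedSymmetricRelation H) : Type _ := AntiDual (HPlus A)

/-- The embedding `H ⊂ H₋`, where `f` acts as `h ↦ (f, h)`. -/
def hToMinus (A : ClosedSymmetricRelation H) : H →L[ℂ] HMinus A :=
  (antiRiesz (HPlus A) : HPlus A →L[ℂ] HMinus A) ∘L ContinuousLinearMap.adjoint (plusToH A)

@[simp] theorem hToMinus_apply (A : ClosedSymmetricRelation H) (f : H) (h : HPlus A) :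
    hToMinus A f h = inner ℂ (plusToH A h) f := by
  change inner ℂ h (ContinuousLinearMap.adjoint (plusToH A) f) = _
  rw [ContinuousLinearMap.adjoint_inner_right]

variable (A : ClosedSymmetricRelation H) {E : Type*} [NormedAddCommGroup E]
  [InnerProductSpace ℂ E] [CompleteSpace E]

/-- The adjoint `T^⟨*⟩ : H₋ → E` of `T : E → H₊`, with `(T^⟨*⟩ 𝔣, ξ) = ⟨𝔣, T ξ⟩₋₊`. -/
def adjOfPlus (T : E →L[ℂ] HPlus A) : HMinus A →L[ℂ] E :=
  ContinuousLinearMap.adjoint T ∘L ((antiRiesz (HPlus A)).symm : HMinus A →L[ℂ] HPlus A)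

/-- The adjoint `T^⟨*⟩ : E → H₊` of `T : H₋ → E`, with `⟨𝔣, T^⟨*⟩ ξ⟩₋₊ = (T 𝔣, ξ)`. -/
def adjFromMinus (T : HMinus A →L[ℂ] E) : E →L[ℂ] HPlus A :=
  ContinuousLinearMap.adjoint (T ∘L (antiRiesz (HPlus A) : HPlus A →L[ℂ] HMinus A))

/-- The adjoint `L^⟨*⟩ : H₊ → E` of `L : E → H₋`, with
`(L^⟨*⟩ h, ξ) = conj ⟨L ξ, h⟩₋₊`. -/
def adjOfMinus (L : E →L[ℂ] HMinus A) : HPlus A →L[ℂ] E :=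
  ContinuousLinearMap.adjoint (((antiRiesz (HPlus A)).symm : HMinus A →L[ℂ] HPlus A) ∘L L)

variable {A}

theorem apply_antiRiesz_symm (𝔣 : HMinus A) (h : HPlus A) :
    inner ℂ h ((antiRiesz (HPlus A)).symm 𝔣) = 𝔣 h := by
  have := congrArg (fun φ : HMinus A => φ h) ((antiRiesz (HPlus A)).apply_symm_apply 𝔣)
  exact this

theorem inner_adjOfPlus (T : E →L[ℂ] HPlus A) (𝔣 : HMinus A) (ξ : E) :
    inner ℂ ξ (adjOfPlus A T 𝔣) = 𝔣 (T ξ) := by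
  rw [adjOfPlus, ContinuousLinearMap.comp_apply, ContinuousLinearMap.adjoint_inner_right]
  exact apply_antiRiesz_symm _ _

theorem apply_adjFromMinus (T : HMinus A →L[ℂ] E) (𝔣 : HMinus A) (ξ : E) :
    𝔣 (adjFromMinus A T ξ) = inner ℂ ξ (T 𝔣) := by
  rw [← apply_antiRiesz_symm, adjFromMinus, ContinuousLinearMap.adjoint_inner_left]
  simp

theorem inner_adjOfMinus (L : E →L[ℂ] HMinus A) (h : HPlus A) (ξ : E) :
    inner ℂ ξ (adjOfMinus A L h) = conj (L ξ h) := by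
  rw [adjOfMinus, ContinuousLinearMap.adjoint_inner_right, ← apply_antiRiesz_symm (L ξ) h]
  exact (inner_conj_symm _ _).symm

end Rigging

section Extended

variable {H : Type u} [NormedAddCommGroup H] [InnerProductSpace ℂ H] [CompleteSpace H]

/-- For `S ⊆ A*`, the relation of all `(f, 𝔣') ∈ H × H₋` with `⟨𝔣', h⟩₋₊ = (f, h')` for all
`(h, h') ∈ S`. -/
def extRel (A : ClosedSymmetricRelation H) (S : Submodule ℂ (H × H)) :
    Submodule ℂ (H × HMinus A) where
  carrier := {x | ∀ (h : HPlus A) (h' : H), (plusToH A h, h') ∈ S → x.2 h = inner ℂ h' x.1}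
  zero_mem' := by intro h h' _; simp
  add_mem' := by
    intro x y hx hy h h' hh
    simp [hx h h' hh, hy h h' hh, inner_add_right]
  smul_mem' := by
    intro c x hx h h' hh
    simp [hx h h' hh, inner_smul_right]

theorem mem_extRel {A : ClosedSymmetricRelation H} {S : Submodule ℂ (H × H)} {f : H}
    {g : HMinus A} : (f, g) ∈ extRel A S ↔
      ∀ (h : HPlus A) (h' : H), (plusToH A h, h') ∈ S → g h = inner ℂ h' f := Iff.rfl

/-- The extension `𝐀 ⊂ H × H₋` of `A`. -/
def boldRel (A : ClosedSymmetricRelation H) : Submodule ℂ (H × HMinus A) :=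
  extRel A A.rel.adjoint

/-- The relation `A^⟨*⟩ ⊂ H × H₋`, the adjoint of `A` with respect to the rigging. -/
def starRel (A : ClosedSymmetricRelation H) : Submodule ℂ (H × HMinus A) := extRel A A.rel

theorem isClosed_boldRel (A : ClosedSymmetricRelation H) :
    IsClosed (boldRel A : Set (H × HMinus A)) := by
  have : (boldRel A : Set (H × HMinus A)) =
      ⋂ (h : HPlus A) (h' : H) (_ : (plusToH A h, h') ∈ A.rel.adjoint),
        {x : H × HMinus A | x.2 h = inner ℂ h' x.1} := by
    ext ⟨f, g⟩
    simp only [SetLike.mem_coe, boldRel, mem_extRel, Set.mem_iInter, Set.mem_ofPred_eq]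
  rw [this]
  refine isClosed_iInter fun h => isClosed_iInter fun h' => isClosed_iInter fun _ => ?_
  exact isClosed_eq ((AntiDual.continuous_eval h).comp continuous_snd) (by fun_prop)

/-- The map `(f, 𝔣') ↦ 𝔣' - z f` from `H × H₋` to `H₋`. -/
def minusShift (A : ClosedSymmetricRelation H) (z : ℂ) : H × HMinus A →L[ℂ] HMinus A :=
  ContinuousLinearMap.snd ℂ H (HMinus A) - z • (hToMinus A ∘L ContinuousLinearMap.fst ℂ H (HMinus A))

@[simp] theorem minusShift_apply (A : ClosedSymmetricRelation H) (z : ℂ) (x : H × HMinus A) :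
    minusShift A z x = x.2 - z • hToMinus A x.1 := by simp [minusShift]

/-- The subspace `ran(𝐀 - z I) ⊂ H₋`. -/
def ranBold (A : ClosedSymmetricRelation H) (z : ℂ) : Submodule ℂ (HMinus A) :=
  (boldRel A).map (minusShift A z : H × HMinus A →ₗ[ℂ] HMinus A)

/-- The set `ρ(A, 𝓛)` of `𝓛`-regular points: points `z` of regular type of `A` for which `H₋` is
the direct sum of `ran(𝐀 - z I)` and `𝓛`. -/
def regularSet (A : ClosedSymmetricRelation H) (𝓛 : Submodule ℂ (HMinus A)) : Set ℂ :=
  {z | z ∈ regularTypePoints A.rel ∧ IsCompl (ranBold A z) 𝓛}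

/-- The set `ρ_s(A, 𝓛)`, the intersection of `ρ(A, 𝓛)` with its complex conjugate. -/
def symRegularSet (A : ClosedSymmetricRelation H) (𝓛 : Submodule ℂ (HMinus A)) : Set ℂ :=
  {z | z ∈ regularSet A 𝓛 ∧ conj z ∈ regularSet A 𝓛}

/-- The space `ℂ^p` with its Euclidean inner product. -/
abbrev Cp (p : ℕ) : Type := EuclideanSpace ℂ (Fin p)

section Gauge

variable {A : ClosedSymmetricRelation H} {p : ℕ} {𝓛 : Submodule ℂ (HMinus A)} (L : Cp p ≃L[ℂ] 𝓛)

/-- The isomorphism `L : ℂ^p → 𝓛`, as a map to `H₋`. -/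
def gaugeMap : Cp p →L[ℂ] HMinus A := 𝓛.subtypeL ∘L (L : Cp p →L[ℂ] 𝓛)

theorem continuous_skewProjection [CompleteSpace 𝓛] {z : ℂ} (h : IsCompl (ranBold A z) 𝓛) :
    Continuous (Submodule.projectionOnto 𝓛 (ranBold A z) h.symm) := by
  have : CompleteSpace (boldRel A) := (isClosed_boldRel A).completeSpace_coe
  let S : (boldRel A × 𝓛) →L[ℂ] HMinus A :=
    (minusShift A z ∘L (boldRel A).subtypeL).coprod 𝓛.subtypeL
  have hS : Function.Surjective S := by
    intro 𝔣
    have h1 : 𝔣 ∈ ranBold A z ⊔ 𝓛 := by rw [h.sup_eq_top]; exact Submodule.mem_top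
    obtain ⟨a, ⟨x, hx, rfl⟩, l, hl, rfl⟩ := Submodule.mem_sup.mp h1
    exact ⟨(⟨x, hx⟩, ⟨l, hl⟩), rfl⟩
  rw [(S.isQuotientMap hS).continuous_iff]
  have hcomp : (Submodule.projectionOnto 𝓛 (ranBold A z) h.symm) ∘ S = fun x => x.2 := by
    funext ⟨x, l⟩
    have h1 : Submodule.projectionOnto 𝓛 (ranBold A z) h.symm (minusShift A z x.1) = 0 :=
      Submodule.projectionOnto_apply_right h.symm ⟨_, ⟨x.1, x.2, rfl⟩⟩
    have h2 : Submodule.projectionOnto 𝓛 (ranBold A z) h.symm (l : HMinus A) = l :=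
      Submodule.projectionOnto_apply_left h.symm l
    change Submodule.projectionOnto 𝓛 (ranBold A z) h.symm (minusShift A z x.1 + l) = l
    rw [map_add, h1, h2, zero_add]
  rw [hcomp]
  exact continuous_snd

theorem completeSpace_gauge (L : Cp p ≃L[ℂ] 𝓛) : CompleteSpace 𝓛 := by
  have : FiniteDimensional ℂ 𝓛 := Module.Finite.equiv L.toLinearEquiv
  exact (Submodule.closed_of_finiteDimensional 𝓛).completeSpace_coe

/-- The operator function of the first kind `𝒫(z) = L⁻¹ Π^z : H₋ → ℂ^p`, where `Π^z` is the skew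
projection of `H₋` onto `𝓛` parallel to `ran(𝐀 - z I)`. -/
def opP (z : ℂ) (hz : z ∈ regularSet A 𝓛) : HMinus A →L[ℂ] Cp p :=
  (L.symm : 𝓛 →L[ℂ] Cp p) ∘L
    { toLinearMap := Submodule.projectionOnto 𝓛 (ranBold A z) hz.2.symm
      cont := by
        have := completeSpace_gauge L
        exact continuous_skewProjection hz.2 }

theorem gaugeMap_opP (z : ℂ) (hz : z ∈ regularSet A 𝓛) (𝔣 : HMinus A) :
    gaugeMap L (opP L z hz 𝔣) = Submodule.projectionOnto 𝓛 (ranBold A z) hz.2.symm 𝔣 := by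
  simp [gaugeMap, opP]

theorem opP_ranBold (z : ℂ) (hz : z ∈ regularSet A 𝓛) {𝔣 : HMinus A} (h : 𝔣 ∈ ranBold A z) :
    opP L z hz 𝔣 = 0 := by
  have : Submodule.projectionOnto 𝓛 (ranBold A z) hz.2.symm 𝔣 = 0 :=
    Submodule.projectionOnto_apply_right hz.2.symm ⟨𝔣, h⟩
  simp [opP, this]

end Gauge

/-- A selfadjoint extension of `A` in a possibly larger Hilbert space. -/
structure SelfadjointExtension (A : ClosedSymmetricRelation H) where
  /-- the larger space -/
  space : Type u
  [normedGroup : NormedAddCommGroup space]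
  [innerProduct : InnerProductSpace ℂ space]
  [complete : CompleteSpace space]
  /-- the isometric embedding of `H` -/
  embed : H →ₗᵢ[ℂ] space
  /-- the selfadjoint relation in the larger space -/
  rel : Submodule ℂ (space × space)
  selfadjoint : rel.adjoint = rel
  extends_rel : ∀ f f', (f, f') ∈ A.rel → (embed f, embed f') ∈ rel

attribute [instance] SelfadjointExtension.normedGroup SelfadjointExtension.innerProduct
  SelfadjointExtension.complete

namespace SelfadjointExtension

variable {A : ClosedSymmetricRelation H} (E : SelfadjointExtension A)

theorem isClosed_rel : IsClosed (E.rel : Set (E.space × E.space)) := by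
  rw [← E.selfadjoint]; exact isClosed_adjoint _

/-- The generalized resolvent `𝐑_z = P_H (Ã - z I)⁻¹ |_H` of `A`. -/
def genRes (z : ℂ) (hz : z ∈ resolventPoints E.rel) : H →L[ℂ] H :=
  ContinuousLinearMap.adjoint E.embed.toContinuousLinearMap ∘L
    relResolvent E.rel E.isClosed_rel z hz ∘L E.embed.toContinuousLinearMap

theorem genRes_mem (z : ℂ) (hz : z ∈ resolventPoints E.rel) (f : H) :
    (E.genRes z hz f, f + z • E.genRes z hz f) ∈ A.rel.adjoint := by
  rw [mem_adjoint]
  intro h h' hh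
  have h1 : (relResolvent E.rel E.isClosed_rel z hz (E.embed f),
      E.embed f + z • relResolvent E.rel E.isClosed_rel z hz (E.embed f)) ∈ E.rel.adjoint := by
    rw [E.selfadjoint]; exact relResolvent_mem _ hz _
  have h2 := mem_adjoint.mp h1 _ _ (E.extends_rel h h' hh)
  have h3 : ∀ v : H, inner ℂ v (E.genRes z hz f) =
      inner ℂ (E.embed v) (relResolvent E.rel E.isClosed_rel z hz (E.embed f)) := by
    intro v
    simp only [genRes, ContinuousLinearMap.comp_apply]
    rw [ContinuousLinearMap.adjoint_inner_right]
    rfl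
  rw [inner_add_right, inner_smul_right, h3, h3, h2, inner_add_right, inner_smul_right,
    LinearIsometry.inner_map_map]

theorem genRes_apply (z : ℂ) (hz : z ∈ resolventPoints E.rel) {f f' : H} (h : (f, f') ∈ A.rel) :
    E.genRes z hz (f' - z • f) = f := by
  refine ext_inner_left ℂ fun v => ?_
  simp only [genRes, ContinuousLinearMap.comp_apply]
  rw [ContinuousLinearMap.adjoint_inner_right]
  have := relResolvent_apply E.isClosed_rel hz (E.extends_rel f f' h)
  change inner ℂ (E.embed v) (relResolvent E.rel E.isClosed_rel z hz (E.embed (f' - z • f))) = _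
  rw [map_sub, map_smul, this, LinearIsometry.inner_map_map]

/-- The generalized resolvent as a bounded operator from `H` to `H₊`. -/
def resPlus (z : ℂ) (hz : z ∈ resolventPoints E.rel) : H →L[ℂ] HPlus A :=
  adjointToPlus A ∘L
    ((E.genRes z hz).prod (ContinuousLinearMap.id ℂ H + z • E.genRes z hz)).codRestrict
      A.rel.adjoint (fun f => by simpa using E.genRes_mem z hz f)

@[simp] theorem plusToH_resPlus (z : ℂ) (hz : z ∈ resolventPoints E.rel) (f : H) :
    plusToH A (E.resPlus z hz f) = E.genRes z hz f := rfl

/-- The extended generalized resolvent, the adjoint `H₋ → H` of `𝐑_{z̄} : H → H₊`. -/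
def resExt (z : ℂ) (hz : z ∈ resolventPoints E.rel) : HMinus A →L[ℂ] H :=
  adjOfPlus A (E.resPlus (conj z) (conj_mem_resolventPoints E.selfadjoint hz))

theorem resExt_mem (z : ℂ) (hz : z ∈ resolventPoints E.rel) (𝔣 : HMinus A) :
    (E.resExt z hz 𝔣, 𝔣 + z • hToMinus A (E.resExt z hz 𝔣)) ∈ starRel A := by
  intro h h' hh
  have hz' := conj_mem_resolventPoints E.selfadjoint hz
  have h1 : E.resPlus (conj z) hz' (h' - conj z • plusToH A h) = h := by
    apply plusToH_injective A
    rw [plusToH_resPlus, E.genRes_apply _ _ hh]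
  have h2 : inner ℂ (h' - conj z • plusToH A h) (E.resExt z hz 𝔣) = 𝔣 h := by
    rw [resExt, inner_adjOfPlus, h1]
  rw [inner_sub_left, inner_smul_left, Complex.conj_conj] at h2
  simp only [AntiDual.add_apply, AntiDual.smul_apply, hToMinus_apply,
    smul_eq_mul]
  rw [← h2]
  ring

end SelfadjointExtension

/-- A boundary triple `(ℂ^p, Γ₀, Γ₁)` for `A*`. -/
structure BoundaryTriple (A : ClosedSymmetricRelation H) (p : ℕ) where
  /-- the boundary map `Γ₀` -/
  Γ₀ : A.rel.adjoint →ₗ[ℂ] Cp p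
  /-- the boundary map `Γ₁` -/
  Γ₁ : A.rel.adjoint →ₗ[ℂ] Cp p
  green : ∀ f g : A.rel.adjoint,
    inner ℂ g.1.1 f.1.2 - inner ℂ g.1.2 f.1.1 = inner ℂ (Γ₀ g) (Γ₁ f) - inner ℂ (Γ₁ g) (Γ₀ f)
  surjective : ∀ u v : Cp p, ∃ f, Γ₀ f = u ∧ Γ₁ f = v

namespace BoundaryTriple

variable {A : ClosedSymmetricRelation H} {p : ℕ} (B : BoundaryTriple A p)

/-- The relation `A₀ = ker Γ₀`. -/
def A₀ : Submodule ℂ (H × H) := B.Γ₀.ker.map A.rel.adjoint.subtype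

theorem mem_A₀ {x : H × H} : x ∈ B.A₀ ↔ ∃ hx : x ∈ A.rel.adjoint, B.Γ₀ ⟨x, hx⟩ = 0 := by
  simp [A₀, LinearMap.mem_ker]

theorem Γ₀_eq_zero {x : A.rel.adjoint} (hx : x.1 ∈ A.rel) : B.Γ₀ x = 0 := by
  obtain ⟨g, hg0, hg1⟩ := B.surjective 0 (B.Γ₀ x)
  have h1 := B.green x g
  have h2 : inner ℂ g.1.1 x.1.2 - inner ℂ g.1.2 x.1.1 = 0 := by
    have := mem_adjoint.mp g.2 x.1.1 x.1.2 hx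
    rw [sub_eq_zero, ← inner_conj_symm g.1.1, ← inner_conj_symm g.1.2, this]
  rw [h2, hg0, hg1, inner_zero_left, zero_sub, eq_comm, neg_eq_zero] at h1
  exact inner_self_eq_zero.mp h1

theorem rel_le_A₀ : A.rel ≤ B.A₀ := fun _ hx =>
  B.mem_A₀.mpr ⟨A.symmetric hx, B.Γ₀_eq_zero hx⟩

theorem A₀_selfadjoint : B.A₀.adjoint = B.A₀ := by
  apply le_antisymm
  · rintro ⟨f, f'⟩ hf
    have hfA : (f, f') ∈ A.rel.adjoint := by
      rw [mem_adjoint] at hf ⊢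
      exact fun h h' hh => hf h h' (B.rel_le_A₀ hh)
    refine B.mem_A₀.mpr ⟨hfA, ?_⟩
    obtain ⟨g, hg0, hg1⟩ := B.surjective 0 (B.Γ₀ ⟨(f, f'), hfA⟩)
    have h1 := B.green ⟨(f, f'), hfA⟩ g
    have h2 := mem_adjoint.mp hf g.1.1 g.1.2 (B.mem_A₀.mpr ⟨g.2, hg0⟩)
    simp only [h2, sub_self, hg0, hg1, inner_zero_left, zero_sub] at h1
    exact inner_self_eq_zero.mp (neg_eq_zero.mp h1.symm)
  · rintro ⟨f, f'⟩ hf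
    rw [mem_adjoint]
    intro h h' hh
    obtain ⟨hfA, hf0⟩ := B.mem_A₀.mp hf
    obtain ⟨hhA, hh0⟩ := B.mem_A₀.mp hh
    have h1 := B.green ⟨(f, f'), hfA⟩ ⟨(h, h'), hhA⟩
    rw [hf0, hh0, inner_zero_left, inner_zero_right, sub_self, sub_eq_zero] at h1
    exact h1.symm

/-- The selfadjoint extension `A₀ = ker Γ₀` of `A` in `H` itself. -/
abbrev ext₀ : SelfadjointExtension A where
  space := H
  embed := LinearIsometry.id
  rel := B.A₀
  selfadjoint := B.A₀_selfadjoint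
  extends_rel := fun _ _ h => B.rel_le_A₀ h

theorem I_mem : Complex.I ∈ resolventPoints B.ext₀.rel :=
  mem_resolventPoints_of_im_ne_zero B.ext₀.selfadjoint (by simp)

theorem neg_I_mem : -Complex.I ∈ resolventPoints B.ext₀.rel :=
  mem_resolventPoints_of_im_ne_zero B.ext₀.selfadjoint (by simp)

/-- The operator `R⁰ = (R⁰_i + R⁰_{-i}) / 2 : H → H₊`, where `R⁰_z = (A₀ - z I)⁻¹`. -/
def regPlus : H →L[ℂ] HPlus A :=
  (1 / 2 : ℂ) • (B.ext₀.resPlus Complex.I B.I_mem + B.ext₀.resPlus (-Complex.I) B.neg_I_mem)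

/-- The regularizing operator `𝐑⁰ = (R⁰)^⟨*⟩ : H₋ → H`. -/
def regExt : HMinus A →L[ℂ] H := adjOfPlus A B.regPlus

theorem regExt_eq (𝔣 : HMinus A) : B.regExt 𝔣 = (1 / 2 : ℂ) •
    (B.ext₀.resExt Complex.I B.I_mem 𝔣 + B.ext₀.resExt (-Complex.I) B.neg_I_mem 𝔣) := by
  refine ext_inner_left ℂ fun v => ?_
  have h1 : ∀ (w : ℂ) (hw : w ∈ resolventPoints B.ext₀.rel) (w' : ℂ)
      (hw' : w' ∈ resolventPoints B.ext₀.rel), conj w = w' →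
      inner ℂ v (B.ext₀.resExt w hw 𝔣) = 𝔣 (B.ext₀.resPlus w' hw' v) := by
    intro w hw w' hw' h
    subst h
    rw [SelfadjointExtension.resExt, inner_adjOfPlus]
  rw [inner_smul_right, inner_add_right, h1 _ _ _ B.neg_I_mem (by simp),
    h1 _ _ _ B.I_mem (by simp), regExt, inner_adjOfPlus, regPlus]
  simp only [smul_apply, add_apply]
  rw [map_smulₛₗ, map_add, add_comm]
  simp only [map_div₀, map_one, map_ofNat, smul_eq_mul]

theorem resExt_sub_regExt_mem (E : SelfadjointExtension A) (z : ℂ) (hz : z ∈ resolventPoints E.rel)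
    (𝔣 : HMinus A) : (E.resExt z hz 𝔣 - B.regExt 𝔣, z • E.resExt z hz 𝔣 - (Complex.I / 2) •
      (B.ext₀.resExt Complex.I B.I_mem 𝔣 - B.ext₀.resExt (-Complex.I) B.neg_I_mem 𝔣)) ∈
      A.rel.adjoint := by
  rw [mem_adjoint]
  intro h h' hh
  obtain ⟨k, rfl⟩ : ∃ k : HPlus A, plusToH A k = h :=
    ⟨adjointToPlus A ⟨(h, h'), A.symmetric hh⟩, rfl⟩
  have h1 := E.resExt_mem z hz 𝔣 k h' hh
  have h2 := B.ext₀.resExt_mem _ B.I_mem 𝔣 k h' hh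
  have h3 := B.ext₀.resExt_mem _ B.neg_I_mem 𝔣 k h' hh
  simp only [AntiDual.add_apply, AntiDual.smul_apply, hToMinus_apply, smul_eq_mul] at h1 h2 h3
  rw [regExt_eq]
  simp only [inner_sub_right, inner_add_right, inner_smul_right, ← h1]
  linear_combination (1 / 2 : ℂ) * h2 + (1 / 2 : ℂ) * h3

/-- The regularized extended generalized resolvent, the difference of the extended generalized
resolvent and the regularizing operator, as a bounded operator from `H₋` to `H₊`. -/
def resReg (E : SelfadjointExtension A) (z : ℂ) (hz : z ∈ resolventPoints E.rel) :
    HMinus A →L[ℂ] HPlus A :=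
  adjointToPlus A ∘L
    ((E.resExt z hz - B.regExt).prod (z • E.resExt z hz - (Complex.I / 2) •
      (B.ext₀.resExt Complex.I B.I_mem - B.ext₀.resExt (-Complex.I) B.neg_I_mem))).codRestrict
      A.rel.adjoint (fun 𝔣 => B.resExt_sub_regExt_mem E z hz 𝔣)

@[simp] theorem plusToH_resReg (E : SelfadjointExtension A) (z : ℂ)
    (hz : z ∈ resolventPoints E.rel) (𝔣 : HMinus A) :
    plusToH A (B.resReg E z hz 𝔣) = E.resExt z hz 𝔣 - B.regExt 𝔣 := rfl

/-! The `γ`-field and the Weyl function. -/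

/-- The defect subspace `{(f, z f) | f ∈ ker (A* - z I)}`, as a subspace of `A*`. -/
def defect (A : ClosedSymmetricRelation H) (z : ℂ) : Submodule ℂ A.rel.adjoint where
  carrier := {x | x.1.2 = z • x.1.1}
  zero_mem' := by simp
  add_mem' := by
    intro x y hx hy
    change x.1.2 + y.1.2 = z • (x.1.1 + y.1.1)
    rw [smul_add, ← hx, ← hy]
  smul_mem' := by
    intro c x hx
    change c • x.1.2 = z • (c • x.1.1)
    rw [smul_comm, ← hx]

theorem Γ₀_defect_bijective (z : ℂ) (hz : z ∈ resolventPoints B.A₀) :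
    Function.Bijective (B.Γ₀ ∘ₗ (defect A z).subtype) := by
  constructor
  · rw [injective_iff_map_eq_zero]
    rintro ⟨⟨⟨f, f'⟩, hf⟩, h1⟩ h2
    change f' = z • f at h1
    subst h1
    have h3 : f ∈ relKer (relShift B.A₀ z) := mem_relKer_shift.mpr (B.mem_A₀.mpr ⟨hf, h2⟩)
    rw [hz.1, Submodule.mem_bot] at h3
    subst h3
    simp
  · intro u
    obtain ⟨f, hf, -⟩ := B.surjective u 0
    have h1 : f.1.2 - z • f.1.1 ∈ relRan (relShift B.A₀ z) := by rw [hz.2]; exact Submodule.mem_top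
    obtain ⟨g, g', hg, hgf⟩ := mem_relRan_shift.mp h1
    obtain ⟨hgA, hg0⟩ := B.mem_A₀.mp hg
    refine ⟨⟨f - ⟨(g, g'), hgA⟩, ?_⟩, ?_⟩
    · change f.1.2 - g' = z • (f.1.1 - g)
      rw [smul_sub, sub_eq_sub_iff_sub_eq_sub]
      exact hgf.symm
    · change B.Γ₀ (f - ⟨(g, g'), hgA⟩) = u
      rw [map_sub, hg0, hf, sub_zero]

/-- The `γ`-field with values in the defect subspaces, the inverse of the restriction of `Γ₀`. -/
def gammaHat (z : ℂ) (hz : z ∈ resolventPoints B.A₀) : Cp p →ₗ[ℂ] defect A z :=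
  (LinearEquiv.ofBijective _ (B.Γ₀_defect_bijective z hz)).symm

/-- The `γ`-field as a bounded operator from `ℂ^p` to `H₊`. -/
def gammaField (z : ℂ) (hz : z ∈ resolventPoints B.A₀) : Cp p →L[ℂ] HPlus A :=
  LinearMap.toContinuousLinearMap
    ((adjointToPlus A : A.rel.adjoint →ₗ[ℂ] HPlus A) ∘ₗ (defect A z).subtype ∘ₗ B.gammaHat z hz)

/-- The Weyl function. -/
def weyl (z : ℂ) (hz : z ∈ resolventPoints B.A₀) : Cp p →ₗ[ℂ] Cp p :=
  B.Γ₁ ∘ₗ (defect A z).subtype ∘ₗ B.gammaHat z hz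

/-! The extended boundary triple. -/

theorem defectPart_mem (z : ℂ) (hz : z ∈ resolventPoints B.A₀) (x : H × HMinus A)
    (hx : x ∈ starRel A) :
    (x.1 - B.ext₀.resExt z hz (minusShift A z x),
      z • (x.1 - B.ext₀.resExt z hz (minusShift A z x))) ∈ A.rel.adjoint := by
  rw [mem_adjoint]
  intro h h' hh
  obtain ⟨k, rfl⟩ : ∃ k : HPlus A, plusToH A k = h :=
    ⟨adjointToPlus A ⟨(h, h'), A.symmetric hh⟩, rfl⟩
  have h1 := B.ext₀.resExt_mem z hz (minusShift A z x) k h' hh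
  have h2 := hx k h' hh
  set y := B.ext₀.resExt z hz (minusShift A z x)
  simp only [AntiDual.add_apply, AntiDual.sub_apply, AntiDual.smul_apply, hToMinus_apply, smul_eq_mul,
    minusShift_apply] at h1
  simp only [inner_sub_right, inner_smul_right, ← h1, h2]
  ring

/-- The component of `x ∈ A^⟨*⟩` in the defect subspace at `z`, with respect to the decomposition
of `A^⟨*⟩` into the vectors `(R̃ 𝔣, 𝔣 + z R̃ 𝔣)`, `𝔣 ∈ H₋`, where `R̃` is the extended resolvent
of `A₀` at `z`, and the defect subspace; here `𝔣 = 𝔣' - z f` for `x = (f, 𝔣')`. -/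
def defectPart (z : ℂ) (hz : z ∈ resolventPoints B.A₀) : starRel A →ₗ[ℂ] A.rel.adjoint :=
  LinearMap.codRestrict A.rel.adjoint
    ((LinearMap.id.prod (z • LinearMap.id)) ∘ₗ
      (LinearMap.fst ℂ H (HMinus A) -
        (B.ext₀.resExt z hz : HMinus A →ₗ[ℂ] H) ∘ₗ (minusShift A z : H × HMinus A →ₗ[ℂ] HMinus A))
      ∘ₗ (starRel A).subtype)
    (fun x => by
      simpa only [LinearMap.comp_apply, LinearMap.prod_apply, Function.prod_apply,
        LinearMap.sub_apply, LinearMap.smul_apply, LinearMap.id_apply, LinearMap.fst_apply,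
        Submodule.subtype_apply, ContinuousLinearMap.coe_coe] using
        B.defectPart_mem z hz x.1 x.2)

/-- The extended boundary map `Γ̂₀ : A^⟨*⟩ → ℂ^p`: it vanishes on the vectors
`(R̃ 𝔣, 𝔣 + z R̃ 𝔣)` and equals `Γ₀` on the defect subspace at `z`. -/
def extΓ₀ (z : ℂ) (hz : z ∈ resolventPoints B.A₀) : starRel A →ₗ[ℂ] Cp p :=
  B.Γ₀ ∘ₗ B.defectPart z hz

/-- The extended boundary map `Γ̂₁ : A^⟨*⟩ → ℂ^p`: it takes `(R̃ 𝔣, 𝔣 + z R̃ 𝔣)` to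
`γ(z̄)^⟨*⟩ 𝔣` and equals `Γ₁` on the defect subspace at `z`. -/
def extΓ₁ (z : ℂ) (hz : z ∈ resolventPoints B.A₀) : starRel A →ₗ[ℂ] Cp p :=
  (adjOfPlus A (B.gammaField (conj z) (conj_mem_resolventPoints B.A₀_selfadjoint hz)) :
      HMinus A →ₗ[ℂ] Cp p) ∘ₗ (minusShift A z : H × HMinus A →ₗ[ℂ] HMinus A) ∘ₗ
      (starRel A).subtype +
    B.Γ₁ ∘ₗ B.defectPart z hz

end BoundaryTriple

end Extended

section SecondKind

variable {H : Type u} [NormedAddCommGroup H] [InnerProductSpace ℂ H] [CompleteSpace H]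
  {A : ClosedSymmetricRelation H} {p : ℕ}

theorem exists_extension_of_real {z : ℂ} (hz : z ∈ regularTypePoints A.rel) (hre : conj z = z) :
    ∃ E : SelfadjointExtension A, z ∈ resolventPoints E.rel := by
  have hcA : CompleteSpace A.rel := A.isClosed.completeSpace_coe
  have hinj : Function.Injective (shiftMap A.rel z) := LinearMap.ker_eq_bot.mp (shiftMap_ker hz.1)
  have hclo : IsClosed (Set.range (shiftMap A.rel z)) := by
    have := hz.2
    rw [← shiftMap_range, LinearMap.coe_range] at this
    exact this
  let M : Submodule ℂ H := (shiftMap A.rel z).range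
  have hM : CompleteSpace M := by
    have h : IsClosed (M : Set H) := by
      change IsClosed ((shiftMap A.rel z).range : Set H)
      rw [LinearMap.coe_range]; exact hclo
    exact h.completeSpace_coe
  let e := ContinuousLinearMap.equivRange hinj hclo
  let X : H →L[ℂ] H := ContinuousLinearMap.fst ℂ H H ∘L A.rel.subtypeL ∘L
    (e.symm : M →L[ℂ] A.rel) ∘L M.orthogonalProjectionOnto
  let P : H →L[ℂ] H := M.starProjection
  let G : H →L[ℂ] H := X + ContinuousLinearMap.adjoint X ∘L (ContinuousLinearMap.id ℂ H - P)
  have hX : ∀ x : A.rel, X (x.1.2 - z • x.1.1) = x.1.1 := by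
    intro x
    have h1 : M.orthogonalProjectionOnto (x.1.2 - z • x.1.1) = e x := by
      have h2 : ((e x : M) : H) = x.1.2 - z • x.1.1 := by rw [← shiftMap_apply]; rfl
      rw [← h2]
      exact Submodule.orthogonalProjectionOnto_mem_subspace_eq_self (e x)
    change (e.symm (M.orthogonalProjectionOnto (x.1.2 - z • x.1.1))).1.1 = x.1.1
    rw [h1, ContinuousLinearEquiv.symm_apply_apply]
  have hXP : ∀ g, X (P g) = X g := by
    intro g
    have h1 : M.orthogonalProjectionOnto (P g) = M.orthogonalProjectionOnto g :=
      Submodule.orthogonalProjectionOnto_mem_subspace_eq_self (M.orthogonalProjectionOnto g)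
    change (e.symm (M.orthogonalProjectionOnto (P g))).1.1 =
      (e.symm (M.orthogonalProjectionOnto g)).1.1
    rw [h1]
  have hrep : ∀ g, ∃ x : A.rel, P g = x.1.2 - z • x.1.1 := by
    intro g
    obtain ⟨x, hx⟩ : P g ∈ M := Submodule.starProjection_apply_mem _ _
    exact ⟨x, by rw [← hx]; exact shiftMap_apply A.rel z x⟩
  have hPs : ∀ g k, inner ℂ (P g) k = inner ℂ g (P k) := fun g k =>
    Submodule.inner_starProjection_left_eq_right M g k
  have hsym : ∀ g k, inner ℂ (P k) (X g) = inner ℂ (X k) (P g) := by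
    intro g k
    obtain ⟨x, hx⟩ := hrep g
    obtain ⟨y, hy⟩ := hrep k
    rw [← hXP g, ← hXP k, hx, hy, hX, hX, inner_sub_left, inner_sub_right, inner_smul_left,
      inner_smul_right, hre, mem_adjoint.mp (A.symmetric x.2) y.1.1 y.1.2 y.2]
  have hGs : ∀ g k, inner ℂ (G k) g = inner ℂ k (G g) := by
    intro g k
    have h1 := hsym g k
    have h2 : inner ℂ (ContinuousLinearMap.adjoint X (k - P k)) g = inner ℂ (k - P k) (X g) :=
      ContinuousLinearMap.adjoint_inner_left _ _ _
    have h3 : inner ℂ k (ContinuousLinearMap.adjoint X (g - P g)) = inner ℂ (X k) (g - P g) :=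
      ContinuousLinearMap.adjoint_inner_right _ _ _
    change inner ℂ (X k + ContinuousLinearMap.adjoint X (k - P k)) g =
      inner ℂ k (X g + ContinuousLinearMap.adjoint X (g - P g))
    rw [inner_add_left, inner_add_right, h2, h3, inner_sub_left, inner_sub_right, h1]
    ring
  let T : Submodule ℂ (H × H) :=
    (((G : H →ₗ[ℂ] H).prod (LinearMap.id + z • (G : H →ₗ[ℂ] H)))).range
  have hT : ∀ u v, (u, v) ∈ T ↔ u = G (v - z • u) := by
    intro u v
    constructor
    · rintro ⟨g, hg⟩
      have h1 : G g = u := congrArg Prod.fst hg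
      have h2 : g + z • G g = v := congrArg Prod.snd hg
      rw [← h2, ← h1, add_sub_cancel_right]
    · intro h
      refine ⟨v - z • u, Prod.ext h.symm ?_⟩
      change (v - z • u) + z • G (v - z • u) = v
      rw [← h, sub_add_cancel]
  refine ⟨⟨H, LinearIsometry.id, T, ?_, ?_⟩, ?_, ?_⟩
  · ext ⟨u, v⟩
    rw [hT, mem_adjoint]
    have h1 : ∀ g, inner ℂ (g + z • G g) u = inner ℂ (G g) v ↔
        inner ℂ g u = inner ℂ g (G (v - z • u)) := by
      intro g
      rw [← hGs, inner_sub_right, inner_add_left, inner_smul_left, inner_smul_right, hre,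
        eq_sub_iff_add_eq]
    constructor
    · intro h
      refine ext_inner_left ℂ fun g => (h1 g).mp ?_
      exact h (G g) (g + z • G g) ((hT _ _).mpr (by rw [add_sub_cancel_right]))
    · intro h a b hab
      have h2 := (hT _ _).mp hab
      have h3 := (h1 (b - z • a)).mpr (by rw [← h])
      rwa [← h2, sub_add_cancel] at h3
  · intro f f' hf
    change (f, f') ∈ T
    rw [hT]
    have h1 : f' - z • f ∈ M := ⟨⟨(f, f'), hf⟩, shiftMap_apply A.rel z _⟩
    have h2 : P (f' - z • f) = f' - z • f := Submodule.starProjection_eq_self_iff.mpr h1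
    change f = X (f' - z • f) + ContinuousLinearMap.adjoint X (f' - z • f - P (f' - z • f))
    rw [h2, sub_self, map_zero, add_zero]
    exact (hX ⟨(f, f'), hf⟩).symm
  · rw [eq_bot_iff]
    intro f hf
    have h1 := (hT _ _).mp (mem_relKer_shift.mp hf)
    rw [sub_self, map_zero] at h1
    exact h1
  · rw [eq_top_iff]
    intro g _
    refine mem_relRan_shift.mpr ⟨G g, g + z • G g, (hT _ _).mpr ?_, ?_⟩
    · rw [add_sub_cancel_right]
    · rw [add_sub_cancel_right]

namespace BoundaryTriple

/-- Every point of regular type is a regular point of some selfadjoint extension. -/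
theorem exists_extension (B : BoundaryTriple A p) {z : ℂ} (hz : z ∈ regularTypePoints A.rel) :
    ∃ E : SelfadjointExtension A, z ∈ resolventPoints E.rel := by
  by_cases h : z.im = 0
  · exact exists_extension_of_real hz (Complex.conj_eq_iff_im.mpr h)
  · exact ⟨B.ext₀, mem_resolventPoints_of_im_ne_zero B.ext₀.selfadjoint h⟩

variable (B : BoundaryTriple A p) {𝓛 : Submodule ℂ (HMinus A)} (L : Cp p ≃L[ℂ] 𝓛)

/-- The operator `L^⟨*⟩ (𝐑_z - 𝐑̂_z Π^z) : H → ℂ^p`, formed with the generalized resolvent `𝐑_z`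
of the selfadjoint extension `E`; here `Π^z = L 𝒫(z)` is the skew projection of `H₋` onto `𝓛`. -/
def opQOf (E : SelfadjointExtension A) (z : ℂ) (hz : z ∈ regularSet A 𝓛)
    (hE : z ∈ resolventPoints E.rel) : H →L[ℂ] Cp p :=
  adjOfMinus A (gaugeMap L) ∘L
    (E.resPlus z hE - B.resReg E z hE ∘L gaugeMap L ∘L opP L z hz ∘L hToMinus A)

/-- The operator function of the second kind `𝒬(z) = L^⟨*⟩ (𝐑_z - 𝐑̂_z Π^z) : H → ℂ^p`, where
`𝐑_z` is any generalized resolvent regular at `z`. One exists by `exists_extension`, and the value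
does not depend on it by `opQ_eq`. -/
def opQ (z : ℂ) (hz : z ∈ regularSet A 𝓛) : H →L[ℂ] Cp p :=
  B.opQOf L (B.exists_extension hz.1).choose z hz (B.exists_extension hz.1).choose_spec

end BoundaryTriple

theorem SelfadjointExtension.resExt_hToMinus (E : SelfadjointExtension A) (z : ℂ)
    (hz : z ∈ resolventPoints E.rel) (f : H) : E.resExt z hz (hToMinus A f) = E.genRes z hz f := by
  have hz' := conj_mem_resolventPoints E.selfadjoint hz
  refine ext_inner_left ℂ fun v => ?_
  rw [resExt, inner_adjOfPlus, hToMinus_apply, plusToH_resPlus]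
  simp only [genRes, ContinuousLinearMap.comp_apply]
  rw [ContinuousLinearMap.adjoint_inner_left, ContinuousLinearMap.adjoint_inner_right]
  set x := E.embed.toContinuousLinearMap f
  set y := E.embed.toContinuousLinearMap v
  have h1 := relResolvent_mem E.isClosed_rel hz x
  have h2 := relResolvent_mem E.isClosed_rel hz' y
  have h3 := mem_adjoint.mp (E.selfadjoint.ge h1) _ _ h2
  rw [inner_add_left, inner_add_right, inner_smul_left, inner_smul_right, Complex.conj_conj] at h3
  exact (add_right_cancel h3).symm

theorem SelfadjointExtension.resExt_boldRel (E : SelfadjointExtension A) (z : ℂ)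
    (hz : z ∈ resolventPoints E.rel) {x : H × HMinus A} (hx : x ∈ boldRel A) :
    E.resExt z hz (minusShift A z x) = x.1 := by
  have hz' := conj_mem_resolventPoints E.selfadjoint hz
  refine ext_inner_left ℂ fun v => ?_
  have h1 := hx (E.resPlus (conj z) hz' v) _ (E.genRes_mem (conj z) hz' v)
  rw [resExt, inner_adjOfPlus, minusShift_apply, AntiDual.sub_apply, AntiDual.smul_apply,
    hToMinus_apply, plusToH_resPlus, h1, inner_add_left, inner_smul_left, Complex.conj_conj]
  ring

theorem BoundaryTriple.opQ_eq (B : BoundaryTriple A p) {𝓛 : Submodule ℂ (HMinus A)}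
    (L : Cp p ≃L[ℂ] 𝓛) (E : SelfadjointExtension A) (z : ℂ) (hz : z ∈ regularSet A 𝓛)
    (hE : z ∈ resolventPoints E.rel) : B.opQ L z hz = B.opQOf L E z hz hE := by
  have key : ∀ (f : H) (x : H × HMinus A), x ∈ boldRel A →
      hToMinus A f = minusShift A z x + gaugeMap L (opP L z hz (hToMinus A f)) →
      ∀ (E : SelfadjointExtension A) (hE : z ∈ resolventPoints E.rel),
      plusToH A (E.resPlus z hE f - B.resReg E z hE (gaugeMap L (opP L z hz (hToMinus A f)))) =
        x.1 + B.regExt (gaugeMap L (opP L z hz (hToMinus A f))) := by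
    intro f x hx hf E hE
    rw [map_sub, SelfadjointExtension.plusToH_resPlus, plusToH_resReg, ← E.resExt_hToMinus, ← E.resExt_boldRel z hE hx,
      (sub_eq_iff_eq_add.mpr hf).symm, map_sub]
    abel
  ext1 f
  have h1 : hToMinus A f - gaugeMap L (opP L z hz (hToMinus A f)) ∈ ranBold A z := by
    rw [gaugeMap_opP, ← Submodule.projectionOnto_apply_eq_zero_iff hz.2.symm, map_sub,
      Submodule.projectionOnto_apply_left, sub_self]
  obtain ⟨x, hx, hxf⟩ := h1
  have hf : hToMinus A f = minusShift A z x + gaugeMap L (opP L z hz (hToMinus A f)) := by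
    rw [← sub_eq_iff_eq_add, ← hxf]; rfl
  change adjOfMinus A (gaugeMap L) _ = adjOfMinus A (gaugeMap L) _
  congr 1
  apply plusToH_injective A
  exact (key f x hx hf _ _).trans (key f x hx hf E hE).symm

end SecondKind

section ResolventMatrix

open Matrix (fromBlocks toEuclideanLin)

open scoped Matrix

/-- The `2p × 2p` matrix of a linear map on `ℂ^p × ℂ^p`, in `p × p` blocks. -/
def blockMatrix {p : ℕ} (T : Cp p × Cp p →ₗ[ℂ] Cp p × Cp p) :
    Matrix (Fin p ⊕ Fin p) (Fin p ⊕ Fin p) ℂ :=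
  fromBlocks
    (toEuclideanLin.symm (LinearMap.fst ℂ (Cp p) (Cp p) ∘ₗ T ∘ₗ LinearMap.inl ℂ (Cp p) (Cp p)))
    (toEuclideanLin.symm (LinearMap.fst ℂ (Cp p) (Cp p) ∘ₗ T ∘ₗ LinearMap.inr ℂ (Cp p) (Cp p)))
    (toEuclideanLin.symm (LinearMap.snd ℂ (Cp p) (Cp p) ∘ₗ T ∘ₗ LinearMap.inl ℂ (Cp p) (Cp p)))
    (toEuclideanLin.symm (LinearMap.snd ℂ (Cp p) (Cp p) ∘ₗ T ∘ₗ LinearMap.inr ℂ (Cp p) (Cp p)))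

/-- The signature matrix `J_p`. -/
def Jp (p : ℕ) : Matrix (Fin p ⊕ Fin p) (Fin p ⊕ Fin p) ℂ :=
  fromBlocks 0 (-(Complex.I • 1)) (Complex.I • 1) 0

namespace BoundaryTriple

variable {H : Type u} [NormedAddCommGroup H] [InnerProductSpace ℂ H] [CompleteSpace H]
  {A : ClosedSymmetricRelation H} {p : ℕ} (B : BoundaryTriple A p)
  {𝓛 : Submodule ℂ (HMinus A)} (L : Cp p ≃L[ℂ] 𝓛)

/-- The adjoint `𝒫(z)^⟨*⟩ : ℂ^p → H₊`. -/
def starP (L : Cp p ≃L[ℂ] 𝓛) (z : ℂ) (hz : z ∈ regularSet A 𝓛) : Cp p →L[ℂ] HPlus A :=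
  adjFromMinus A (opP L z hz)

/-- The adjoint `𝒬(z)^⟨*⟩ = 𝒬(z)* : ℂ^p → H`. -/
def starQ (z : ℂ) (hz : z ∈ regularSet A 𝓛) : Cp p →L[ℂ] H :=
  ContinuousLinearMap.adjoint (B.opQ L z hz)

theorem boldRel_of_mem {f f' : H} (h : (f, f') ∈ A.rel) : (f, hToMinus A f') ∈ boldRel A := by
  intro k k' hk
  rw [hToMinus_apply, ← inner_conj_symm, ← inner_conj_symm k' f]
  congr 1
  exact (mem_adjoint.mp hk f f' h)

theorem shift_mem_ranBold {f f' : H} (h : (f, f') ∈ A.rel) (z : ℂ) :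
    hToMinus A (f' - z • f) ∈ ranBold A z :=
  ⟨_, boldRel_of_mem h, by
    rw [ContinuousLinearMap.coe_coe, minusShift_apply, map_sub, map_smul]⟩

theorem hatP_mem (L : Cp p ≃L[ℂ] 𝓛) (z : ℂ) (hz : z ∈ regularSet A 𝓛) (u : Cp p) :
    (plusToH A (starP L z hz u), conj z • hToMinus A (plusToH A (starP L z hz u))) ∈ starRel A := by
  intro h h' hh
  have h1 : inner ℂ (h' - z • plusToH A h) (plusToH A (starP L z hz u)) = 0 := by
    rw [← inner_conj_symm, ← hToMinus_apply, starP, apply_adjFromMinus,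
      opP_ranBold L z hz (shift_mem_ranBold hh z), inner_zero_right, map_zero]
  rw [inner_sub_left, inner_smul_left, sub_eq_zero] at h1
  rw [AntiDual.smul_apply, hToMinus_apply, h1]

theorem hatQ_mem (z : ℂ) (hz : z ∈ regularSet A 𝓛) (u : Cp p) :
    (B.starQ L z hz u, conj z • hToMinus A (B.starQ L z hz u) + gaugeMap L u) ∈ starRel A := by
  intro h h' hh
  have h0 : B.opQ L z hz (h' - z • plusToH A h) = adjOfMinus A (gaugeMap L) h := by
    have hE := (B.exists_extension hz.1).choose_spec
    set E := (B.exists_extension hz.1).choose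
    rw [B.opQ_eq L E z hz hE]
    simp only [opQOf, ContinuousLinearMap.comp_apply, sub_apply]
    rw [opP_ranBold L z hz (shift_mem_ranBold hh z), map_zero, map_zero, sub_zero]
    congr 1
    apply plusToH_injective A
    rw [SelfadjointExtension.plusToH_resPlus, E.genRes_apply _ _ hh]
  have h1 : inner ℂ (h' - z • plusToH A h) (B.starQ L z hz u) = gaugeMap L u h := by
    rw [starQ, ContinuousLinearMap.adjoint_inner_right, h0, ← inner_conj_symm, inner_adjOfMinus,
      Complex.conj_conj]
  rw [inner_sub_left, inner_smul_left] at h1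
  rw [AntiDual.add_apply, AntiDual.smul_apply, hToMinus_apply, ← h1]
  ring

/-- The map `u ↦ 𝒫̂(z)^⟨*⟩ u = (𝒫(z)^⟨*⟩ u, z̄ 𝒫(z)^⟨*⟩ u)` from `ℂ^p` to `A^⟨*⟩`. -/
def hatP (L : Cp p ≃L[ℂ] 𝓛) (z : ℂ) (hz : z ∈ regularSet A 𝓛) : Cp p →ₗ[ℂ] starRel A where
  toFun u := ⟨_, hatP_mem L z hz u⟩
  map_add' u v := by
    apply Subtype.ext
    simp [map_add, smul_add]
  map_smul' c u := by
    apply Subtype.ext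
    simp [map_smul, smul_comm c]

/-- The map `u ↦ 𝒬̂(z)^⟨*⟩ u = (𝒬(z)^⟨*⟩ u, z̄ 𝒬(z)^⟨*⟩ u + L u)` from `ℂ^p` to `A^⟨*⟩`. -/
def hatQ (z : ℂ) (hz : z ∈ regularSet A 𝓛) : Cp p →ₗ[ℂ] starRel A where
  toFun u := ⟨_, B.hatQ_mem L z hz u⟩
  map_add' u v := by
    apply Subtype.ext
    simp only [map_add, smul_add, Submodule.coe_add, Prod.mk_add_mk, Prod.mk.injEq, true_and]
    abel
  map_smul' c u := by
    apply Subtype.ext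
    simp [map_smul, smul_add, smul_comm c]

/-- `𝒢(z) = col(-𝒬(z), 𝒫(z))`, as an operator from `H` to `ℂ^p × ℂ^p`. -/
def opG (z : ℂ) (hz : z ∈ regularSet A 𝓛) : H →ₗ[ℂ] Cp p × Cp p :=
  (-(B.opQ L z hz : H →ₗ[ℂ] Cp p)).prod ((opP L z hz ∘L hToMinus A : H →L[ℂ] Cp p) : H →ₗ[ℂ] Cp p)

/-- `𝒢(z)^⟨*⟩ = [-𝒬(z)^⟨*⟩, 𝒫(z)^⟨*⟩]`, as an operator from `ℂ^p × ℂ^p` to `H`. -/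
def starG (z : ℂ) (hz : z ∈ regularSet A 𝓛) : Cp p × Cp p →ₗ[ℂ] H :=
  (-(B.starQ L z hz : Cp p →ₗ[ℂ] H)).coprod
    ((plusToH A ∘L starP L z hz : Cp p →L[ℂ] H) : Cp p →ₗ[ℂ] H)

/-- `𝒢̂(z)^⟨*⟩ = [-𝒬̂(z)^⟨*⟩, 𝒫̂(z)^⟨*⟩]`, as a map from `ℂ^p × ℂ^p` to `A^⟨*⟩`. -/
def hatG (z : ℂ) (hz : z ∈ regularSet A 𝓛) : Cp p × Cp p →ₗ[ℂ] starRel A :=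
  (-(B.hatQ L z hz)).coprod (hatP L z hz)

/-- The extended boundary map `Γ̂ = col(Γ̂₀, Γ̂₁) : A^⟨*⟩ → ℂ^p × ℂ^p`, constructed from the
decomposition of `A^⟨*⟩` at the point `z₀ ∈ ρ(A₀)`. -/
def extΓ (z₀ : ℂ) (hz₀ : z₀ ∈ resolventPoints B.A₀) : starRel A →ₗ[ℂ] Cp p × Cp p :=
  (B.extΓ₀ z₀ hz₀).prod (B.extΓ₁ z₀ hz₀)

theorem genRes_ext₀_mem (z : ℂ) (hz : z ∈ resolventPoints B.A₀) (g : H) :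
    (B.ext₀.genRes z hz g, g + z • B.ext₀.genRes z hz g) ∈ B.A₀ := by
  have h : B.ext₀.genRes z hz g = relResolvent B.A₀ B.ext₀.isClosed_rel z hz g := by
    refine ext_inner_left ℂ fun v => ?_
    simp only [SelfadjointExtension.genRes, ContinuousLinearMap.comp_apply]
    rw [ContinuousLinearMap.adjoint_inner_right]
    rfl
  rw [h]
  exact relResolvent_mem _ hz g

/-- The extended boundary map is a continuation of `Γ = col(Γ₀, Γ₁)` from `A*` to `A^⟨*⟩`. -/
theorem extΓ_eq (z₀ : ℂ) (hz₀ : z₀ ∈ resolventPoints B.A₀) (x : A.rel.adjoint)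
    (hx : (x.1.1, hToMinus A x.1.2) ∈ starRel A) :
    B.extΓ z₀ hz₀ ⟨_, hx⟩ = (B.Γ₀ x, B.Γ₁ x) := by
  set g := x.1.2 - z₀ • x.1.1 with hg
  obtain ⟨hgA, hg0⟩ := B.mem_A₀.mp (B.genRes_ext₀_mem z₀ hz₀ g)
  have hz' := conj_mem_resolventPoints B.A₀_selfadjoint hz₀
  have h1 : minusShift A z₀ (x.1.1, hToMinus A x.1.2) = hToMinus A g := by
    rw [minusShift_apply, hg, map_sub, map_smul]
  have h2 : B.defectPart z₀ hz₀ ⟨_, hx⟩ = x - ⟨_, hgA⟩ := by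
    have h3 : B.ext₀.resExt z₀ hz₀ (minusShift A z₀ (x.1.1, hToMinus A x.1.2)) =
        B.ext₀.genRes z₀ hz₀ g := by
      rw [h1]; exact B.ext₀.resExt_hToMinus z₀ hz₀ g
    apply Subtype.ext
    refine Prod.ext ?_ ?_
    · change x.1.1 - B.ext₀.resExt z₀ hz₀ (minusShift A z₀ (x.1.1, hToMinus A x.1.2)) =
        x.1.1 - B.ext₀.genRes z₀ hz₀ g
      rw [h3]
    · change z₀ • (x.1.1 - B.ext₀.resExt z₀ hz₀ (minusShift A z₀ (x.1.1, hToMinus A x.1.2))) =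
        x.1.2 - (g + z₀ • B.ext₀.genRes z₀ hz₀ g)
      rw [h3, hg, smul_sub]
      abel
  have h4 : adjOfPlus A (B.gammaField (conj z₀) hz') (hToMinus A g) = B.Γ₁ ⟨_, hgA⟩ := by
    refine ext_inner_left ℂ fun u => ?_
    rw [inner_adjOfPlus, hToMinus_apply]
    set y := B.gammaHat (conj z₀) hz' u with hy
    have hyu : B.Γ₀ y.1 = u :=
      (LinearEquiv.ofBijective _ (B.Γ₀_defect_bijective (conj z₀) hz')).apply_symm_apply u
    have hy2 : y.1.1.2 = conj z₀ • y.1.1.1 := y.2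
    have h5 := B.green ⟨_, hgA⟩ y.1
    rw [hg0, hyu, inner_zero_right, sub_zero, hy2, inner_smul_left, Complex.conj_conj,
      inner_add_right, inner_smul_right, add_sub_cancel_right] at h5
    exact h5
  have h6 : B.extΓ₀ z₀ hz₀ ⟨_, hx⟩ = B.Γ₀ x := by
    change B.Γ₀ (B.defectPart z₀ hz₀ ⟨_, hx⟩) = _
    rw [h2, map_sub, hg0, sub_zero]
  have h7 : B.extΓ₁ z₀ hz₀ ⟨_, hx⟩ = B.Γ₁ x := by
    change adjOfPlus A (B.gammaField (conj z₀) hz') (minusShift A z₀ (x.1.1, hToMinus A x.1.2)) +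
      B.Γ₁ (B.defectPart z₀ hz₀ ⟨_, hx⟩) = _
    rw [h1, h2, h4, map_sub B.Γ₁ x]
    exact add_sub_cancel _ _
  exact Prod.ext h6 h7

/-- The matrix function `Ŵ(z) = (Γ̂ 𝒢̂(z)^⟨*⟩)*`. -/
def hatW (z₀ : ℂ) (hz₀ : z₀ ∈ resolventPoints B.A₀) (z : ℂ) (hz : z ∈ regularSet A 𝓛) :
    Matrix (Fin p ⊕ Fin p) (Fin p ⊕ Fin p) ℂ :=
  (blockMatrix (B.extΓ z₀ hz₀ ∘ₗ B.hatG L z hz))ᴴ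

/-- The kernel `(J_p - W J_p V*) / (-i (z - ζ̄))`, for `W = Ŵ(z)` and `V = Ŵ(ζ)`. -/
def kernelW (z₀ : ℂ) (hz₀ : z₀ ∈ resolventPoints B.A₀) (z : ℂ) (hz : z ∈ regularSet A 𝓛)
    (ζ : ℂ) (hζ : ζ ∈ regularSet A 𝓛) : Matrix (Fin p ⊕ Fin p) (Fin p ⊕ Fin p) ℂ :=
  (-Complex.I * (z - conj ζ))⁻¹ •
    (Jp p - B.hatW L z₀ hz₀ z hz * Jp p * (B.hatW L z₀ hz₀ ζ hζ)ᴴ)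

/-- The block `𝔞₁₁(z) = M(z)` of the preresolvent matrix. -/
def pre₁₁ (z : ℂ) (hz : z ∈ resolventPoints B.A₀) : Matrix (Fin p) (Fin p) ℂ :=
  toEuclideanLin.symm (B.weyl z hz)

/-- The block `𝔞₁₂(z) = γ(z̄)^⟨*⟩ L` of the preresolvent matrix. -/
def pre₁₂ (z : ℂ) (hz : z ∈ resolventPoints B.A₀) : Matrix (Fin p) (Fin p) ℂ :=
  toEuclideanLin.symm ((adjOfPlus A (B.gammaField (conj z)
    (conj_mem_resolventPoints B.A₀_selfadjoint hz)) ∘L gaugeMap L : Cp p →L[ℂ] Cp p) :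
      Cp p →ₗ[ℂ] Cp p)

/-- The block `𝔞₂₁(z) = L^⟨*⟩ γ(z)` of the preresolvent matrix. -/
def pre₂₁ (z : ℂ) (hz : z ∈ resolventPoints B.A₀) : Matrix (Fin p) (Fin p) ℂ :=
  toEuclideanLin.symm ((adjOfMinus A (gaugeMap L) ∘L B.gammaField z hz : Cp p →L[ℂ] Cp p) :
    Cp p →ₗ[ℂ] Cp p)

/-- The block `𝔞₂₂(z) = L^⟨*⟩ R̂⁰_z L` of the preresolvent matrix, where `R̂⁰_z` is the regularized
extended resolvent of `A₀`. -/
def pre₂₂ (z : ℂ) (hz : z ∈ resolventPoints B.A₀) : Matrix (Fin p) (Fin p) ℂ :=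
  toEuclideanLin.symm ((adjOfMinus A (gaugeMap L) ∘L B.resReg B.ext₀ z hz ∘L gaugeMap L :
    Cp p →L[ℂ] Cp p) : Cp p →ₗ[ℂ] Cp p)

/-- The right `Π𝓛`-resolvent matrix of `A`. -/
def rightResolventMatrix (z : ℂ) (hz : z ∈ resolventPoints B.A₀) :
    Matrix (Fin p ⊕ Fin p) (Fin p ⊕ Fin p) ℂ :=
  fromBlocks
    (B.pre₂₂ L z hz * (B.pre₁₂ L z hz)⁻¹)
    (B.pre₂₂ L z hz * (B.pre₁₂ L z hz)⁻¹ * B.pre₁₁ z hz - B.pre₂₁ L z hz)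
    (B.pre₁₂ L z hz)⁻¹
    ((B.pre₁₂ L z hz)⁻¹ * B.pre₁₁ z hz)

end BoundaryTriple

end ResolventMatrix

end LResolvent

end

open LResolvent

open scoped Matrix

/-! The kernel identity is a Green formula. For (f, 𝔣') and (g, 𝔤') in A^⟨*⟩ the pairing of 𝔣' with
g has no meaning in general, because g need only lie in H. The regularized vector g - 𝐑⁰𝔤' does lie
in H₊, and `extGreen` states that ⟨𝔣', g - 𝐑⁰𝔤'⟩ - conj ⟨𝔤', f - 𝐑⁰𝔣'⟩ is the boundary form of the
extended boundary maps. If 𝔣' and 𝔤' lie in H, both vectors belong to A*, the correction terms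
cancel because 𝐑⁰ is symmetric on H, and the ordinary Green formula remains. The general case
follows by density of H in H₋, along the parametrization of A^⟨*⟩ by H₋ and a defect subspace
(`exists_decomposition`).

This identity is applied to 𝒢̂(ζ)^⟨*⟩v and 𝒢̂(z)^⟨*⟩w. The relation 𝒫(z)L = I and the explicit form
of 𝒬(z)* (`starQ_eq`) give the normalization `adjOfMinus_regPart_hatG`: L^⟨*⟩ recovers the second
coordinate of v. With it, the left side of the Green identity becomes (ζ̄ - z)(𝒢(ζ)^⟨*⟩v, 𝒢(z)^⟨*⟩w)
plus the form defined by J_p on (v, w). Since Ŵ(z) is the adjoint of Γ̂𝒢̂(z)^⟨*⟩, this is the kernel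
identity. Taking ζ = z̄ gives J_p = Ŵ(z) J_p Ŵ(z̄)*, whence invertibility.

For the resolvent matrix, the extended boundary maps do not depend on the base point
(`extΓ_eq_extΓ`), so z̄ may be used. There 𝒫̂(z)^⟨*⟩ = γ̂(z̄)C, where L^⟨*⟩γ(z̄)C = I forces C* =
𝔞₁₂(z)⁻¹, and 𝒬̂(z)^⟨*⟩u is the resolvent vector of Lu minus 𝒫̂(z)^⟨*⟩ applied to 𝔞₂₂(z̄)u. The four
blocks can then be read off. -/

noncomputable section

namespace LResolvent

/-! ### Density of H in H₋ and continuity of the duality. -/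

section Duality

variable {H : Type*} [NormedAddCommGroup H] [InnerProductSpace ℂ H] [CompleteSpace H]
  (A : ClosedSymmetricRelation H)

/-- `H` is dense in `H₋`. -/
theorem denseRange_hToMinus : DenseRange (hToMinus A) := by
  have h1 : DenseRange (ContinuousLinearMap.adjoint (plusToH A)) := by
    -- Up to the Riesz identification, the embedding of H in H₋ is the adjoint of the embedding of
    -- H₊ in H, so its range is dense because the latter is injective.
    have h2 : (ContinuousLinearMap.adjoint (plusToH A)).rangeᗮ = ⊥ := by
      rw [ContinuousLinearMap.orthogonal_range, ContinuousLinearMap.adjoint_adjoint]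
      exact LinearMap.ker_eq_bot.mpr (plusToH_injective A)
    have h3 := (Submodule.topologicalClosure_eq_top_iff).mpr h2
    have h4 := Submodule.dense_iff_topologicalClosure_eq_top.mpr h3
    rwa [LinearMap.coe_range] at h4
  exact (antiRiesz (HPlus A)).surjective.denseRange.comp h1 (antiRiesz (HPlus A)).continuous

variable {A} in
-- By the Riesz identification the duality is the inner product of H₊. Continuity in both arguments
-- at once is what the later density arguments need, where functional and vector vary together.
theorem continuous_duality {X : Type*} [TopologicalSpace X] {φ : X → HMinus A} {h : X → HPlus A}
    (hφ : Continuous φ) (hh : Continuous h) : Continuous fun x => φ x (h x) := by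
  simp only [← apply_antiRiesz_symm]
  exact hh.inner ((antiRiesz (HPlus A)).symm.continuous.comp hφ)

end Duality

/-! ### The regularizing operator and the extended Green identity. -/

section Green

universe u

variable {H : Type u} [NormedAddCommGroup H] [InnerProductSpace ℂ H] [CompleteSpace H]
  {A : ClosedSymmetricRelation H} {p : ℕ}

/-- `A*` is contained in `A^⟨*⟩`. -/
theorem adjoint_mem_starRel {x : H × H} (hx : x ∈ A.rel.adjoint) :
    (x.1, hToMinus A x.2) ∈ starRel A := by
  intro h h' hh
  rw [hToMinus_apply]
  exact (mem_adjoint.mp hx _ _ hh).symm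

/-- A vector of `A^⟨*⟩` whose second component lies in `H` belongs to `A*`. -/
theorem mem_adjoint_of_mem_starRel {f f' : H} (hx : (f, hToMinus A f') ∈ starRel A) :
    (f, f') ∈ A.rel.adjoint := by
  rw [mem_adjoint]
  intro h h' hh
  have := hx (adjointToPlus A ⟨(h, h'), A.symmetric hh⟩) h' hh
  rw [hToMinus_apply] at this
  exact this.symm

/-- The embedding of `A*` in `A^⟨*⟩`. -/
def adjointToStar (x : A.rel.adjoint) : starRel A := ⟨_, adjoint_mem_starRel x.2⟩

namespace SelfadjointExtension

variable (E : SelfadjointExtension A)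

theorem inner_genRes (z : ℂ) (hz : z ∈ resolventPoints E.rel) (f g : H) :
    inner ℂ g (E.genRes z hz f) =
      inner ℂ (E.genRes (conj z) (conj_mem_resolventPoints E.selfadjoint hz) g) f := by
  rw [← E.resExt_hToMinus, resExt, inner_adjOfPlus, hToMinus_apply, plusToH_resPlus]

end SelfadjointExtension

namespace BoundaryTriple

variable (B : BoundaryTriple A p)

theorem plusToH_regPlus (f : H) : plusToH A (B.regPlus f) = B.regExt (hToMinus A f) := by
  rw [regExt_eq, SelfadjointExtension.resExt_hToMinus, SelfadjointExtension.resExt_hToMinus]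
  rfl

theorem inner_regExt (𝔣 : HMinus A) (g : H) : inner ℂ g (B.regExt 𝔣) = 𝔣 (B.regPlus g) :=
  inner_adjOfPlus _ _ _

/-- Symmetry comes from averaging the resolvents at the conjugate points i and -i, which taking
adjoints interchanges. It makes the regularizing terms cancel in the Green identities. -/
theorem inner_regExt_hToMinus (f g : H) :
    inner ℂ g (B.regExt (hToMinus A f)) = inner ℂ (B.regExt (hToMinus A g)) f := by
  rw [inner_regExt, hToMinus_apply, plusToH_regPlus]

/-- The regularized extended resolvents at conjugate points are adjoint to each other. -/
theorem resReg_adjoint (E : SelfadjointExtension A) (z : ℂ) (hz : z ∈ resolventPoints E.rel)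
    (𝔣 𝔤 : HMinus A) : 𝔤 (B.resReg E z hz 𝔣) =
      conj (𝔣 (B.resReg E (conj z) (conj_mem_resolventPoints E.selfadjoint hz) 𝔤)) := by
  -- Both sides are continuous in (𝔣, 𝔤). On H they reduce to the adjoint relation between
  -- generalized resolvents at conjugate points and the symmetry of 𝐑⁰.
  induction 𝔣, 𝔤 using (denseRange_hToMinus A).induction_on₂ with
  | hp =>
    exact isClosed_eq (continuous_duality (by fun_prop) (by fun_prop))
      (Complex.continuous_conj.comp (continuous_duality (by fun_prop) (by fun_prop)))
  | h f g =>
    rw [hToMinus_apply, hToMinus_apply, inner_conj_symm, plusToH_resReg, plusToH_resReg,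
      inner_sub_left, inner_sub_right, E.resExt_hToMinus, E.resExt_hToMinus,
      ← inner_regExt_hToMinus, ← inner_conj_symm, E.inner_genRes, inner_conj_symm]

/-- This is half the sum of the vectors (R̃ 𝔣, 𝔣 + w R̃ 𝔣) of A^⟨*⟩ at w = i and w = -i. Its second
component differs from 𝔣 by an element of H only. -/
theorem regExt_mem_starRel (𝔣 : HMinus A) : (B.regExt 𝔣, 𝔣 + hToMinus A ((Complex.I / 2) •
      (B.ext₀.resExt Complex.I B.I_mem 𝔣 - B.ext₀.resExt (-Complex.I) B.neg_I_mem 𝔣))) ∈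
      starRel A := by
  have h1 := (starRel A).smul_mem (1 / 2 : ℂ) ((starRel A).add_mem
    (B.ext₀.resExt_mem _ B.I_mem 𝔣) (B.ext₀.resExt_mem _ B.neg_I_mem 𝔣))
  convert h1 using 1
  refine Prod.ext (B.regExt_eq 𝔣) ?_
  simp only [map_smul, map_sub, Prod.smul_snd, Prod.snd_add]
  module

/-- Subtracting the vector of `regExt_mem_starRel` cancels the part of the second component outside
H, and what remains lies in A*. Hence f - 𝐑⁰𝔣' is in dom A* and can be paired with H₋. -/
theorem sub_regExt_mem {x : H × HMinus A} (hx : x ∈ starRel A) : (x.1 - B.regExt x.2,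
    -((Complex.I / 2) • (B.ext₀.resExt Complex.I B.I_mem x.2 -
      B.ext₀.resExt (-Complex.I) B.neg_I_mem x.2))) ∈ A.rel.adjoint := by
  apply mem_adjoint_of_mem_starRel
  convert (starRel A).sub_mem hx (B.regExt_mem_starRel x.2) using 1
  refine Prod.ext rfl ?_
  rw [map_neg, Prod.snd_sub, sub_add_cancel_left]

/-- The regularization `(f, 𝔣') ↦ f - 𝐑⁰ 𝔣'`, as a bounded operator from `A^⟨*⟩` to `H₊`. -/
def regPart : starRel A →L[ℂ] HPlus A :=
  adjointToPlus A ∘L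
    (((ContinuousLinearMap.fst ℂ H (HMinus A) -
      B.regExt ∘L ContinuousLinearMap.snd ℂ H (HMinus A)).prod
      (-((Complex.I / 2) • ((B.ext₀.resExt Complex.I B.I_mem -
        B.ext₀.resExt (-Complex.I) B.neg_I_mem) ∘L ContinuousLinearMap.snd ℂ H (HMinus A))))) ∘L
      (starRel A).subtypeL).codRestrict A.rel.adjoint (fun x => B.sub_regExt_mem x.2)

@[simp] theorem plusToH_regPart (x : starRel A) :
    plusToH A (B.regPart x) = x.1.1 - B.regExt x.1.2 := rfl

/-! ### The extended boundary maps on resolvent vectors and defect vectors. -/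

variable (z : ℂ) (hz : z ∈ resolventPoints B.A₀)

/-- The vector `(R̃ 𝔣, 𝔣 + z R̃ 𝔣)` of `A^⟨*⟩`. -/
def resStar (𝔣 : HMinus A) : starRel A := ⟨_, B.ext₀.resExt_mem z hz 𝔣⟩

theorem Γ₀_gammaHat (u : Cp p) : B.Γ₀ (B.gammaHat z hz u).1 = u :=
  (LinearEquiv.ofBijective _ (B.Γ₀_defect_bijective z hz)).apply_symm_apply u

theorem Γ₁_gammaHat (u : Cp p) : B.Γ₁ (B.gammaHat z hz u).1 = B.weyl z hz u := rfl

theorem gammaHat_snd (u : Cp p) :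
    (B.gammaHat z hz u).1.1.2 = z • (B.gammaHat z hz u).1.1.1 := (B.gammaHat z hz u).2

/-- The Green formula for defect vectors at z and z̄ has zero left side, and their Γ₀ values are v
and u. -/
theorem weyl_adjoint (u v : Cp p) :
    inner ℂ u (B.weyl z hz v) =
      inner ℂ (B.weyl (conj z) (conj_mem_resolventPoints B.A₀_selfadjoint hz) u) v := by
  set hz' := conj_mem_resolventPoints B.A₀_selfadjoint hz
  have h := B.green (B.gammaHat z hz v).1 (B.gammaHat (conj z) hz' u).1
  rw [gammaHat_snd, gammaHat_snd, Γ₀_gammaHat, Γ₀_gammaHat, Γ₁_gammaHat, Γ₁_gammaHat,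
    inner_smul_left, inner_smul_right, Complex.conj_conj, sub_self] at h
  exact (sub_eq_zero.mp h.symm)

theorem extΓ_adjointToStar (x : A.rel.adjoint) :
    B.extΓ z hz (adjointToStar x) = (B.Γ₀ x, B.Γ₁ x) := B.extΓ_eq z hz x _

theorem minusShift_resStar (w : ℂ) (𝔣 : HMinus A) :
    minusShift A w (B.resStar z hz 𝔣).1 = 𝔣 + (z - w) • hToMinus A (B.ext₀.resExt z hz 𝔣) := by
  rw [minusShift_apply]
  simp only [resStar]
  module

theorem extΓ_resStar (𝔣 : HMinus A) : B.extΓ z hz (B.resStar z hz 𝔣) =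
    (0, adjOfPlus A (B.gammaField (conj z)
      (conj_mem_resolventPoints B.A₀_selfadjoint hz)) 𝔣) := by
  have h1 : minusShift A z (B.resStar z hz 𝔣).1 = 𝔣 := by
    rw [minusShift_resStar, sub_self, zero_smul, add_zero]
  have h2 : B.defectPart z hz (B.resStar z hz 𝔣) = 0 := by
    apply Subtype.ext
    change (B.ext₀.resExt z hz 𝔣 - B.ext₀.resExt z hz (minusShift A z (B.resStar z hz 𝔣).1),
      z • (B.ext₀.resExt z hz 𝔣 - B.ext₀.resExt z hz (minusShift A z (B.resStar z hz 𝔣).1))) = 0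
    rw [h1, sub_self, smul_zero, Prod.mk_zero_zero]
  refine Prod.ext ?_ ?_
  · change B.Γ₀ (B.defectPart z hz (B.resStar z hz 𝔣)) = 0
    rw [h2, map_zero]
  · change adjOfPlus A _ (minusShift A z (B.resStar z hz 𝔣).1) +
      B.Γ₁ (B.defectPart z hz (B.resStar z hz 𝔣)) = _
    rw [h1, h2, map_zero, add_zero]

/-- On H the extended resolvent is the ordinary resolvent of A₀. Density arguments over H₋ thus
reduce to vectors of A*, where the extended maps agree with Γ. -/
theorem resStar_hToMinus (f : H) : ∃ x : A.rel.adjoint,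
    B.resStar z hz (hToMinus A f) = adjointToStar x := by
  obtain ⟨h1, -⟩ := B.mem_A₀.mp (B.genRes_ext₀_mem z hz f)
  refine ⟨⟨_, h1⟩, Subtype.ext (Prod.ext (B.ext₀.resExt_hToMinus z hz f) ?_)⟩
  change hToMinus A f + z • hToMinus A (B.ext₀.resExt z hz (hToMinus A f)) =
    hToMinus A (f + z • B.ext₀.genRes z hz f)
  rw [B.ext₀.resExt_hToMinus, map_add, map_smul]

/-- For x = (f, 𝔣') take 𝔣 = 𝔣' - z f. Subtracting the resolvent vector of 𝔣 leaves a defect vector,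
which γ̂(z) recovers from its Γ₀ value. -/
theorem exists_decomposition (x : starRel A) : ∃ (𝔣 : HMinus A) (u : Cp p),
    x = B.resStar z hz 𝔣 + adjointToStar (B.gammaHat z hz u).1 := by
  refine ⟨minusShift A z x.1, B.Γ₀ (B.defectPart z hz x), ?_⟩
  have h1 : B.gammaHat z hz (B.Γ₀ (B.defectPart z hz x)) = ⟨B.defectPart z hz x, rfl⟩ :=
    (LinearEquiv.ofBijective _ (B.Γ₀_defect_bijective z hz)).symm_apply_apply
      ⟨B.defectPart z hz x, rfl⟩
  rw [h1]
  apply Subtype.ext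
  refine Prod.ext ?_ ?_
  · change x.1.1 = B.ext₀.resExt z hz (minusShift A z x.1) +
      (x.1.1 - B.ext₀.resExt z hz (minusShift A z x.1))
    abel
  · change x.1.2 = minusShift A z x.1 + z • hToMinus A (B.ext₀.resExt z hz (minusShift A z x.1)) +
      hToMinus A (z • (x.1.1 - B.ext₀.resExt z hz (minusShift A z x.1)))
    rw [map_smul, map_sub]
    nth_rw 1 [minusShift_apply]
    module

theorem continuous_resStar : Continuous (B.resStar z hz) := by
  refine Continuous.subtype_mk ?_ _
  fun_prop

/-- A resolvent vector at z is also a resolvent vector at w, with 𝔣 replaced by 𝔣 + (z - w)R̃ 𝔣. It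
therefore has no defect component at w, and the extended boundary map is an explicit bounded
expression in 𝔣. -/
theorem continuous_extΓ_resStar (w : ℂ) (hw : w ∈ resolventPoints B.A₀) :
    Continuous fun 𝔣 => B.extΓ w hw (B.resStar z hz 𝔣) := by
  -- The resolvent identity of A₀, extended from H to H₋ by density.
  have h0 : ∀ 𝔣, B.ext₀.resExt z hz 𝔣 =
      B.ext₀.resExt w hw (minusShift A w (B.resStar z hz 𝔣).1) := by
    intro 𝔣
    rw [minusShift_resStar]
    induction 𝔣 using (denseRange_hToMinus A).induction_on with
    | hp => exact isClosed_eq (by fun_prop) (by fun_prop)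
    | ih f =>
      have h1 := B.genRes_ext₀_mem z hz f
      have h2 := relResolvent_apply B.ext₀.isClosed_rel hw h1
      have h3 : ∀ g, B.ext₀.genRes w hw g = relResolvent B.A₀ B.ext₀.isClosed_rel w hw g := by
        intro g
        refine ext_inner_left ℂ fun v => ?_
        simp only [SelfadjointExtension.genRes, ContinuousLinearMap.comp_apply]
        rw [ContinuousLinearMap.adjoint_inner_right]
        rfl
      rw [B.ext₀.resExt_hToMinus, ← map_smul, ← map_add, B.ext₀.resExt_hToMinus, h3]
      convert h2.symm using 2
      module
  have h2 : ∀ 𝔣, B.defectPart w hw (B.resStar z hz 𝔣) = 0 := by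
    intro 𝔣
    apply Subtype.ext
    change (B.ext₀.resExt z hz 𝔣 - B.ext₀.resExt w hw (minusShift A w (B.resStar z hz 𝔣).1),
      w • (B.ext₀.resExt z hz 𝔣 - B.ext₀.resExt w hw (minusShift A w (B.resStar z hz 𝔣).1))) = 0
    rw [← h0, sub_self, smul_zero, Prod.mk_zero_zero]
  have h3 : ∀ 𝔣, B.extΓ w hw (B.resStar z hz 𝔣) = (0, adjOfPlus A (B.gammaField (conj w)
      (conj_mem_resolventPoints B.A₀_selfadjoint hw)) (minusShift A w (B.resStar z hz 𝔣).1)) := by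
    intro 𝔣
    refine Prod.ext ?_ ?_
    · change B.Γ₀ (B.defectPart w hw (B.resStar z hz 𝔣)) = 0
      rw [h2, map_zero]
    · change adjOfPlus A _ (minusShift A w (B.resStar z hz 𝔣).1) +
        B.Γ₁ (B.defectPart w hw (B.resStar z hz 𝔣)) = _
      rw [h2, map_zero, add_zero]
  simp only [h3, minusShift_resStar]
  fun_prop

/-- The extended boundary map does not depend on the point used to construct it. -/
theorem extΓ_eq_extΓ (w : ℂ) (hw : w ∈ resolventPoints B.A₀) : B.extΓ z hz = B.extΓ w hw := by
  ext1 x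
  obtain ⟨𝔣, u, rfl⟩ := B.exists_decomposition z hz x
  rw [map_add, map_add, extΓ_adjointToStar, extΓ_adjointToStar]
  -- The defect vector lies in A*, where both maps equal Γ, so only the resolvent vector remains to
  -- be compared.
  congr 1
  induction 𝔣 using (denseRange_hToMinus A).induction_on with
  | hp =>
    exact isClosed_eq (B.continuous_extΓ_resStar z hz z hz) (B.continuous_extΓ_resStar z hz w hw)
  | ih f =>
    obtain ⟨x, hx⟩ := B.resStar_hToMinus z hz f
    rw [hx, extΓ_adjointToStar, extΓ_adjointToStar]

/-- The regularized Green identity for the extended boundary triple. -/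
theorem extGreen (x y : starRel A) :
    x.1.2 (B.regPart y) - conj (y.1.2 (B.regPart x)) =
      inner ℂ (B.extΓ z hz y).1 (B.extΓ z hz x).2 -
        inner ℂ (B.extΓ z hz y).2 (B.extΓ z hz x).1 := by
  obtain ⟨𝔣, u, rfl⟩ := B.exists_decomposition z hz x
  obtain ⟨𝔤, v, rfl⟩ := B.exists_decomposition z hz y
  have hc := B.continuous_resStar z hz
  have hc' := B.continuous_extΓ_resStar z hz z hz
  -- Only the H₋ parameters are approximated; the defect components stay fixed and already lie in
  -- A*.
  induction 𝔣, 𝔤 using (denseRange_hToMinus A).induction_on₂ with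
  | hp =>
    obtain ⟨F, hF⟩ : ∃ F : HMinus A → Cp p × Cp p, ∀ 𝔣, B.extΓ z hz (B.resStar z hz 𝔣) = F 𝔣 :=
      ⟨_, fun _ => rfl⟩
    simp only [hF] at hc'
    simp only [map_add (B.extΓ z hz), hF]
    refine isClosed_eq (Continuous.sub (continuous_duality ?_ ?_)
      (Complex.continuous_conj.comp (continuous_duality ?_ ?_))) ?_
    all_goals fun_prop
  | h f g =>
    obtain ⟨x, hx⟩ := B.resStar_hToMinus z hz f
    obtain ⟨y, hy⟩ := B.resStar_hToMinus z hz g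
    have hadd : ∀ a b : A.rel.adjoint,
        adjointToStar a + adjointToStar b = adjointToStar (a + b) := fun a b =>
      Subtype.ext (Prod.ext rfl (map_add (hToMinus A) _ _).symm)
    rw [hx, hy, hadd, hadd, extΓ_adjointToStar, extΓ_adjointToStar]
    generalize x + (B.gammaHat z hz u).1 = a
    generalize y + (B.gammaHat z hz v).1 = b
    rw [← B.green]
    change hToMinus A a.1.2 _ - conj (hToMinus A b.1.2 _) = _
    rw [hToMinus_apply, hToMinus_apply, inner_conj_symm, plusToH_regPart, plusToH_regPart]
    change inner ℂ (b.1.1 - B.regExt (hToMinus A b.1.2)) a.1.2 -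
      inner ℂ b.1.2 (a.1.1 - B.regExt (hToMinus A a.1.2)) = _
    -- The two regularizing terms coincide by symmetry of 𝐑⁰ and cancel, leaving the Green formula
    -- on A*.
    rw [inner_sub_left, inner_sub_right, inner_regExt_hToMinus]
    ring

end BoundaryTriple

end Green

open Matrix (toEuclideanLin)

/-! ### Block matrices, adjoints and the signature form on ℂ^p × ℂ^p. -/

section Matrices

variable {p : ℕ}

theorem toEuclideanLin_symm_comp (S T : Cp p →ₗ[ℂ] Cp p) :
    (toEuclideanLin.symm (S ∘ₗ T) : Matrix (Fin p) (Fin p) ℂ) =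
      toEuclideanLin.symm S * toEuclideanLin.symm T := by
  apply toEuclideanLin.injective
  rw [LinearEquiv.apply_symm_apply]
  ext1 v
  have h : ∀ (R : Cp p →ₗ[ℂ] Cp p) (x : Cp p),
      (toEuclideanLin.symm R : Matrix (Fin p) (Fin p) ℂ) *ᵥ x.ofLp = (R x).ofLp := by
    intro R x
    have h := Matrix.toLpLin_apply 2 2 (toEuclideanLin.symm R) x
    rw [LinearEquiv.apply_symm_apply] at h
    exact (congrArg WithLp.ofLp h).symm
  rw [Matrix.toLpLin_apply, ← Matrix.mulVec_mulVec, h, h, LinearMap.comp_apply]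

theorem toEuclideanLin_symm_one :
    (toEuclideanLin.symm (LinearMap.id : Cp p →ₗ[ℂ] Cp p) : Matrix (Fin p) (Fin p) ℂ) = 1 := by
  rw [LinearEquiv.symm_apply_eq]
  ext1 v
  rw [Matrix.toLpLin_apply, Matrix.one_mulVec]
  rfl

theorem toEuclideanLin_symm_conjTranspose {S T : Cp p →ₗ[ℂ] Cp p}
    (h : ∀ u v, inner ℂ (S u) v = inner ℂ u (T v)) :
    (toEuclideanLin.symm T : Matrix (Fin p) (Fin p) ℂ)ᴴ = toEuclideanLin.symm S := by
  rw [LinearEquiv.eq_symm_apply, Matrix.toEuclideanLin_conjTranspose_eq_adjoint,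
    LinearEquiv.apply_symm_apply]
  exact ((LinearMap.eq_adjoint_iff S T).mpr h).symm

theorem blockMatrix_comp (S T : Cp p × Cp p →ₗ[ℂ] Cp p × Cp p) :
    blockMatrix (S ∘ₗ T) = blockMatrix S * blockMatrix T := by
  simp only [blockMatrix, Matrix.fromBlocks_multiply, ← toEuclideanLin_symm_comp, ← map_add]
  -- The identity of ℂ^p × ℂ^p, split into its two coordinate projections, is inserted between the
  -- factors; this is block multiplication.
  have h : ∀ R : Cp p →ₗ[ℂ] Cp p × Cp p, S ∘ₗ R =
      S ∘ₗ LinearMap.inl ℂ (Cp p) (Cp p) ∘ₗ LinearMap.fst ℂ (Cp p) (Cp p) ∘ₗ R +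
        S ∘ₗ LinearMap.inr ℂ (Cp p) (Cp p) ∘ₗ LinearMap.snd ℂ (Cp p) (Cp p) ∘ₗ R := by
    intro R
    ext1 v
    simp [← map_add]
  congr 2 <;> (rw [LinearMap.comp_assoc, h]; rfl)

theorem blockMatrix_sub (S T : Cp p × Cp p →ₗ[ℂ] Cp p × Cp p) :
    blockMatrix (S - T) = blockMatrix S - blockMatrix T := by
  ext (i | i) (j | j) <;>
    simp [blockMatrix, LinearMap.sub_comp, LinearMap.comp_sub]

theorem blockMatrix_smul (c : ℂ) (T : Cp p × Cp p →ₗ[ℂ] Cp p × Cp p) :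
    blockMatrix (c • T) = c • blockMatrix T := by
  simp only [blockMatrix, Matrix.fromBlocks_smul, ← map_smul]
  rfl

/-- The map `(a, b) ↦ (-i b, i a)`. -/
def signatureMap (p : ℕ) : Cp p × Cp p →ₗ[ℂ] Cp p × Cp p :=
  (-(Complex.I • LinearMap.snd ℂ (Cp p) (Cp p))).prod (Complex.I • LinearMap.fst ℂ (Cp p) (Cp p))

theorem signatureMap_apply (v : Cp p × Cp p) :
    signatureMap p v = (-(Complex.I • v.2), Complex.I • v.1) := rfl

theorem blockMatrix_signatureMap : blockMatrix (signatureMap p) = Jp p := by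
  rw [blockMatrix, Jp, ← toEuclideanLin_symm_one, ← map_smul, ← map_neg,
    ← map_zero (toEuclideanLin (𝕜 := ℂ) (m := Fin p) (n := Fin p)).symm]
  congr 2 <;> ext1 v <;> simp [signatureMap_apply]

theorem Jp_mul_Jp : Jp p * Jp p = 1 := by
  rw [Jp, Matrix.fromBlocks_multiply, ← Matrix.fromBlocks_one]
  congr 1 <;> simp [smul_smul]

/-- The adjoint of a linear map on `ℂ^p × ℂ^p` with respect to the Euclidean inner product. -/
def prodAdjoint (T : Cp p × Cp p →ₗ[ℂ] Cp p × Cp p) : Cp p × Cp p →ₗ[ℂ] Cp p × Cp p :=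
  ((LinearMap.adjoint (LinearMap.fst ℂ (Cp p) (Cp p) ∘ₗ T ∘ₗ LinearMap.inl ℂ (Cp p) (Cp p))).coprod
    (LinearMap.adjoint
      (LinearMap.snd ℂ (Cp p) (Cp p) ∘ₗ T ∘ₗ LinearMap.inl ℂ (Cp p) (Cp p)))).prod
  ((LinearMap.adjoint (LinearMap.fst ℂ (Cp p) (Cp p) ∘ₗ T ∘ₗ LinearMap.inr ℂ (Cp p) (Cp p))).coprod
    (LinearMap.adjoint (LinearMap.snd ℂ (Cp p) (Cp p) ∘ₗ T ∘ₗ LinearMap.inr ℂ (Cp p) (Cp p))))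

theorem blockMatrix_conjTranspose (T : Cp p × Cp p →ₗ[ℂ] Cp p × Cp p) :
    (blockMatrix T)ᴴ = blockMatrix (prodAdjoint T) := by
  rw [blockMatrix, Matrix.fromBlocks_conjTranspose, blockMatrix]
  congr 1 <;> refine toEuclideanLin_symm_conjTranspose fun u v => ?_ <;>
    simp [prodAdjoint, LinearMap.adjoint_inner_left]

/-- The Euclidean inner product of `ℂ^p × ℂ^p`. -/
def prodInner (v w : Cp p × Cp p) : ℂ := inner ℂ v.1 w.1 + inner ℂ v.2 w.2

theorem prodInner_prodAdjoint (T : Cp p × Cp p →ₗ[ℂ] Cp p × Cp p) (v w : Cp p × Cp p) :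
    prodInner v (prodAdjoint T w) = prodInner (T v) w := by
  have h : T v = T (v.1, 0) + T (0, v.2) := by rw [← map_add]; simp
  simp only [prodInner, prodAdjoint, h, LinearMap.prod_apply, Function.prod_apply,
    LinearMap.coprod_apply, inner_add_right, inner_add_left, Prod.fst_add, Prod.snd_add,
    LinearMap.adjoint_inner_right, LinearMap.comp_apply, LinearMap.fst_apply, LinearMap.snd_apply,
    LinearMap.inl_apply, LinearMap.inr_apply]
  ring

theorem ext_prodInner {S T : Cp p × Cp p →ₗ[ℂ] Cp p × Cp p}
    (h : ∀ v w, prodInner v (S w) = prodInner v (T w)) : S = T := by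
  refine LinearMap.ext fun w => Prod.ext ?_ ?_
  · refine ext_inner_left ℂ fun u => ?_
    simpa [prodInner] using h (u, 0) w
  · refine ext_inner_left ℂ fun u => ?_
    simpa [prodInner] using h (0, u) w

end Matrices

universe u

/-! ### The operators 𝒫, 𝒬, 𝒢 and the kernel identity. -/

section Gauge

variable {H : Type u} [NormedAddCommGroup H] [InnerProductSpace ℂ H] [CompleteSpace H]
  {A : ClosedSymmetricRelation H} {p : ℕ} {𝓛 : Submodule ℂ (HMinus A)} (L : Cp p ≃L[ℂ] 𝓛)

theorem opP_gaugeMap (z : ℂ) (hz : z ∈ regularSet A 𝓛) (u : Cp p) :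
    opP L z hz (gaugeMap L u) = u := by
  have h : Submodule.projectionOnto 𝓛 (ranBold A z) hz.2.symm (gaugeMap L u) = L u :=
    Submodule.projectionOnto_apply_left hz.2.symm (L u)
  change L.symm (Submodule.projectionOnto 𝓛 (ranBold A z) hz.2.symm (gaugeMap L u)) = u
  rw [h, ContinuousLinearEquiv.symm_apply_apply]

theorem adjOfMinus_inner (u : Cp p) (h : HPlus A) :
    inner ℂ (adjOfMinus A (gaugeMap L) h) u = gaugeMap L u h := by
  rw [← inner_conj_symm, inner_adjOfMinus, Complex.conj_conj]

namespace BoundaryTriple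

/-- This is the adjoint of 𝒫(z)L = I, which holds because the skew projection fixes 𝓛. -/
theorem adjOfMinus_starP (z : ℂ) (hz : z ∈ regularSet A 𝓛) (u : Cp p) :
    adjOfMinus A (gaugeMap L) (starP L z hz u) = u := by
  refine ext_inner_right ℂ fun v => ?_
  rw [adjOfMinus_inner, starP, apply_adjFromMinus, opP_gaugeMap]

variable (B : BoundaryTriple A p)

theorem resReg_hToMinus (E : SelfadjointExtension A) (z : ℂ) (hz : z ∈ resolventPoints E.rel)
    (f : H) : B.resReg E z hz (hToMinus A f) = E.resPlus z hz f - B.regPlus f := by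
  apply plusToH_injective A
  rw [plusToH_resReg, map_sub, E.resExt_hToMinus, plusToH_regPlus,
    SelfadjointExtension.plusToH_resPlus]

/-- On H one has 𝐑_z = 𝐑̂_z + R⁰, and the adjoint of 𝐑̂_z is 𝐑̂ at z̄. Taking adjoints in the
definition of 𝒬(z) isolates 𝐑⁰Lu, the part that need not lie in H₊, from the remainder (I -
𝒫(z)^⟨*⟩L^⟨*⟩)𝐑̂ Lu, which does. -/
theorem starQ_eq (E : SelfadjointExtension A) (z : ℂ) (hz : z ∈ regularSet A 𝓛)
    (hE : z ∈ resolventPoints E.rel) (hE' : conj z ∈ resolventPoints E.rel) (u : Cp p) :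
    B.starQ L z hz u = B.regExt (gaugeMap L u) +
      plusToH A (B.resReg E (conj z) hE' (gaugeMap L u) -
        starP L z hz (adjOfMinus A (gaugeMap L) (B.resReg E (conj z) hE' (gaugeMap L u)))) := by
  refine ext_inner_left ℂ fun v => ?_
  have h1 : E.resPlus z hE v = B.resReg E z hE (hToMinus A v) + B.regPlus v := by
    rw [resReg_hToMinus, sub_add_cancel]
  rw [starQ, ContinuousLinearMap.adjoint_inner_right, B.opQ_eq L E z hz hE]
  change inner ℂ (adjOfMinus A (gaugeMap L) (E.resPlus z hE v -
    B.resReg E z hE (gaugeMap L (opP L z hz (hToMinus A v))))) u = _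
  rw [adjOfMinus_inner, inner_add_right, inner_regExt, ← inner_conj_symm v (plusToH A _),
    ← inner_conj_symm, Complex.conj_conj, ← inner_conj_symm, ← hToMinus_apply, h1, map_sub, map_add,
    map_sub, starP, apply_adjFromMinus, adjOfMinus_inner,
    B.resReg_adjoint E z hE (hToMinus A v) (gaugeMap L u),
    B.resReg_adjoint E z hE (gaugeMap L (opP L z hz (hToMinus A v))) (gaugeMap L u), map_sub]
  ring

/-- The first component of `𝒢̂(z)^⟨*⟩ v`. -/
theorem hatG_fst (z : ℂ) (hz : z ∈ regularSet A 𝓛) (v : Cp p × Cp p) :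
    (B.hatG L z hz v).1.1 = B.starG L z hz v := rfl

theorem hatG_snd (z : ℂ) (hz : z ∈ regularSet A 𝓛) (v : Cp p × Cp p) :
    (B.hatG L z hz v).1.2 =
      conj z • hToMinus A (B.starG L z hz v) - gaugeMap L v.1 := by
  change -(conj z • hToMinus A (B.starQ L z hz v.1) + gaugeMap L v.1) +
    conj z • hToMinus A (plusToH A (starP L z hz v.2)) =
    conj z • hToMinus A (-(B.starQ L z hz v.1) + plusToH A (starP L z hz v.2)) - gaugeMap L v.1
  rw [map_add, map_neg]
  module

/-- Regularization removes the term 𝐑⁰Lv₁ of 𝒬(z)*v₁, and the summand with R⁰ compensates for the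
part z̄𝒢(z)^⟨*⟩v of the second component. What is left is 𝒫(z)^⟨*⟩v₂ minus a vector of the form r -
𝒫(z)^⟨*⟩L^⟨*⟩r, which L^⟨*⟩ annihilates. -/
theorem adjOfMinus_regPart_hatG (z : ℂ) (hz : z ∈ regularSet A 𝓛) (v : Cp p × Cp p) :
    adjOfMinus A (gaugeMap L) (B.regPart (B.hatG L z hz v) +
      conj z • B.regPlus (B.starG L z hz v)) = v.2 := by
  obtain ⟨E, hE⟩ := B.exists_extension hz.1
  have hE' := conj_mem_resolventPoints E.selfadjoint hE
  set r := B.resReg E (conj z) hE' (gaugeMap L v.1) with hr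
  have h : B.regPart (B.hatG L z hz v) + conj z • B.regPlus (B.starG L z hz v) =
      starP L z hz v.2 - (r - starP L z hz (adjOfMinus A (gaugeMap L) r)) := by
    apply plusToH_injective A
    have h1 : B.starG L z hz v = -B.starQ L z hz v.1 + plusToH A (starP L z hz v.2) := rfl
    rw [map_add, map_smul, plusToH_regPart, hatG_fst, hatG_snd, plusToH_regPlus, map_sub B.regExt,
      map_smul B.regExt, map_sub (plusToH A), h1, B.starQ_eq L E z hz hE hE', ← hr]
    module
  rw [h, map_sub, map_sub, adjOfMinus_starP, adjOfMinus_starP, sub_self, sub_zero]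

/-- The Green identity for the vectors `𝒢̂(ζ)^⟨*⟩ v` and `𝒢̂(z)^⟨*⟩ w`. -/
theorem extGreen_hatG (z₀ : ℂ) (hz₀ : z₀ ∈ resolventPoints B.A₀) (z : ℂ)
    (hz : z ∈ regularSet A 𝓛) (ζ : ℂ) (hζ : ζ ∈ regularSet A 𝓛) (v w : Cp p × Cp p) :
    inner ℂ (B.extΓ z₀ hz₀ (B.hatG L z hz w)).1 (B.extΓ z₀ hz₀ (B.hatG L ζ hζ v)).2 -
      inner ℂ (B.extΓ z₀ hz₀ (B.hatG L z hz w)).2 (B.extΓ z₀ hz₀ (B.hatG L ζ hζ v)).1 =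
    (conj ζ - z) * inner ℂ (B.starG L z hz w) (B.starG L ζ hζ v) +
      (inner ℂ w.1 v.2 - inner ℂ w.2 v.1) := by
  rw [← extGreen]
  -- The normalization turns the coordinates v₂ and w₂ into pairings with Lw₁ and Lv₁, the same
  -- pairings that the Green identity produces.
  have hv : inner ℂ w.1 v.2 = conj (gaugeMap L w.1 (B.regPart (B.hatG L ζ hζ v))) +
      conj ζ * conj (gaugeMap L w.1 (B.regPlus (B.starG L ζ hζ v))) := by
    rw [← B.adjOfMinus_regPart_hatG L ζ hζ v, inner_adjOfMinus, map_add, map_smulₛₗ, map_add,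
      smul_eq_mul, map_mul, Complex.conj_conj]
  have hw : inner ℂ w.2 v.1 = gaugeMap L v.1 (B.regPart (B.hatG L z hz w)) +
      z * gaugeMap L v.1 (B.regPlus (B.starG L z hz w)) := by
    rw [← B.adjOfMinus_regPart_hatG L z hz w, adjOfMinus_inner, map_add, map_smulₛₗ,
      smul_eq_mul, Complex.conj_conj]
  rw [hv, hw, hatG_snd, hatG_snd]
  set f := B.starG L ζ hζ v with hf
  set g := B.starG L z hz w with hg
  have h1 : ∀ (k : HMinus A) (x : H), inner ℂ (B.regExt k) x = conj (k (B.regPlus x)) := by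
    intro k x
    rw [← inner_conj_symm, inner_regExt]
  -- The terms containing both ζ̄ and z carry R⁰ between f and g, and cancel by symmetry.
  have h2 : inner ℂ g (plusToH A (B.regPlus f)) = inner ℂ (plusToH A (B.regPlus g)) f := by
    rw [plusToH_regPlus, plusToH_regPlus, inner_regExt_hToMinus]
  simp only [AntiDual.sub_apply, AntiDual.smul_apply, hToMinus_apply, plusToH_regPart, hatG_fst,
    hatG_snd, ← hf, ← hg, map_sub, map_mul, inner_conj_symm, inner_sub_left, Complex.conj_conj,
    map_smul, inner_smul_left, inner_regExt]
  simp only [h1, hToMinus_apply, inner_conj_symm, h2]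
  ring

theorem prodInner_opG (z : ℂ) (hz : z ∈ regularSet A 𝓛) (w : Cp p × Cp p) (f : H) :
    prodInner w (B.opG L z hz f) = inner ℂ (B.starG L z hz w) f := by
  change inner ℂ w.1 (-(B.opQ L z hz f)) + inner ℂ w.2 (opP L z hz (hToMinus A f)) =
    inner ℂ (-(B.starQ L z hz w.1) + plusToH A (starP L z hz w.2)) f
  rw [inner_add_left, inner_neg_left, inner_neg_right, starQ,
    ContinuousLinearMap.adjoint_inner_left, starP, ← hToMinus_apply, apply_adjFromMinus]

/-- Tested on a pair (w, v), the matrix Ŵ(z) moves to the left argument as Γ̂𝒢̂(z)^⟨*⟩, and the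
identity becomes `extGreen_hatG`. -/
theorem kernel_identity (z₀ : ℂ) (hz₀ : z₀ ∈ resolventPoints B.A₀) (z : ℂ)
    (hz : z ∈ regularSet A 𝓛) (ζ : ℂ) (hζ : ζ ∈ regularSet A 𝓛) :
    Jp p - B.hatW L z₀ hz₀ z hz * Jp p * (B.hatW L z₀ hz₀ ζ hζ)ᴴ =
      (-Complex.I * (z - conj ζ)) • blockMatrix (B.opG L z hz ∘ₗ B.starG L ζ hζ) := by
  rw [hatW, hatW, Matrix.conjTranspose_conjTranspose, blockMatrix_conjTranspose,
    ← blockMatrix_signatureMap, ← blockMatrix_comp, ← blockMatrix_comp, ← blockMatrix_sub,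
    ← blockMatrix_smul]
  congr 1
  refine ext_prodInner fun w v => ?_
  have hsub : ∀ a b : Cp p × Cp p, prodInner w (a - b) = prodInner w a - prodInner w b := by
    intro a b
    simp only [prodInner, Prod.fst_sub, Prod.snd_sub, inner_sub_right]
    ring
  have hsmul : ∀ (c : ℂ) (a : Cp p × Cp p), prodInner w (c • a) = c * prodInner w a := by
    intro c a
    simp only [prodInner, Prod.smul_fst, Prod.smul_snd, inner_smul_right]
    ring
  simp only [LinearMap.sub_apply, LinearMap.smul_apply, LinearMap.comp_apply, hsub, hsmul,
    prodInner_prodAdjoint, prodInner_opG]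
  have h := B.extGreen_hatG L z₀ hz₀ z hz ζ hζ v w
  simp only [prodInner, signatureMap_apply, inner_neg_right, inner_smul_right]
  -- The factor i converts the boundary form into the form of J_p, and i(ζ̄ - z) is -i(z - ζ̄).
  linear_combination Complex.I * h

theorem isUnit_hatW (z₀ : ℂ) (hz₀ : z₀ ∈ resolventPoints B.A₀) {z : ℂ}
    (hz : z ∈ symRegularSet A 𝓛) : IsUnit (B.hatW L z₀ hz₀ z hz.1) := by
  have h := B.kernel_identity L z₀ hz₀ z hz.1 (conj z) hz.2
  rw [Complex.conj_conj, sub_self, mul_zero, zero_smul, sub_eq_zero] at h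
  -- The kernel identity at ζ = z̄ reads J_p = Ŵ(z) J_p Ŵ(z̄)*; multiplying by J_p on the right and
  -- using J_p² = I exhibits this inverse.
  refine IsUnit.of_mul_eq_one (Jp p * (B.hatW L z₀ hz₀ (conj z) hz.2)ᴴ * Jp p) ?_
  rw [← Matrix.mul_assoc, ← Matrix.mul_assoc, ← h, Jp_mul_Jp]

/-! The resolvent matrix at regular points of `A₀`. -/

/-- A vector (f, z f) of A^⟨*⟩ has its second component in H, so it is a defect vector of A*, and
there γ̂(z) inverts Γ₀. -/
theorem gammaHat_extΓ (z : ℂ) (hz : z ∈ resolventPoints B.A₀) (x : starRel A)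
    (hx : x.1.2 = z • hToMinus A x.1.1) :
    x = adjointToStar (B.gammaHat z hz (B.extΓ z hz x).1).1 := by
  have hA : (x.1.1, z • x.1.1) ∈ A.rel.adjoint :=
    mem_adjoint_of_mem_starRel (by rw [map_smul, ← hx]; exact x.2)
  have h1 : x = adjointToStar ⟨_, hA⟩ :=
    Subtype.ext (Prod.ext rfl (by rw [hx, ← map_smul]; rfl))
  have h2 : B.gammaHat z hz (B.Γ₀ ⟨_, hA⟩) = ⟨⟨_, hA⟩, rfl⟩ :=
    (LinearEquiv.ofBijective _ (B.Γ₀_defect_bijective z hz)).symm_apply_apply ⟨⟨_, hA⟩, rfl⟩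
  have h3 : (B.extΓ z hz x).1 = B.Γ₀ ⟨_, hA⟩ := by
    conv_lhs => rw [h1, extΓ_adjointToStar]
  rw [h3, h2]
  exact h1

/-- The conjugate point is a separate variable because the relation is used for both ordered pairs
(z, z̄) and (z̄, z). -/
theorem pre₁₂_conjTranspose (z : ℂ) (hz : z ∈ resolventPoints B.A₀) (w : ℂ)
    (hw : w ∈ resolventPoints B.A₀) (h : w = conj z) : (B.pre₁₂ L z hz)ᴴ = B.pre₂₁ L w hw := by
  subst h
  refine toEuclideanLin_symm_conjTranspose fun u v => ?_
  change inner ℂ (adjOfMinus A (gaugeMap L) (B.gammaField (conj z) hw u)) v =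
    inner ℂ u (adjOfPlus A (B.gammaField (conj z) hw) (gaugeMap L v))
  rw [adjOfMinus_inner, inner_adjOfPlus]

theorem pre₁₁_conjTranspose (z : ℂ) (hz : z ∈ resolventPoints B.A₀) :
    (B.pre₁₁ (conj z) (conj_mem_resolventPoints B.A₀_selfadjoint hz))ᴴ = B.pre₁₁ z hz := by
  refine toEuclideanLin_symm_conjTranspose fun u v => ?_
  rw [← inner_conj_symm, weyl_adjoint, inner_conj_symm]

theorem pre₂₂_conjTranspose (z : ℂ) (hz : z ∈ resolventPoints B.A₀) :
    (B.pre₂₂ L (conj z) (conj_mem_resolventPoints B.A₀_selfadjoint hz))ᴴ = B.pre₂₂ L z hz := by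
  refine toEuclideanLin_symm_conjTranspose fun u v => ?_
  change inner ℂ (adjOfMinus A (gaugeMap L) (B.resReg B.ext₀ z hz (gaugeMap L u))) v =
    inner ℂ u (adjOfMinus A (gaugeMap L) (B.resReg B.ext₀ (conj z) _ (gaugeMap L v)))
  rw [adjOfMinus_inner, inner_adjOfMinus, B.resReg_adjoint]

/-- The decomposition of `𝒬̂(z)^⟨*⟩ u` at a regular point of `A₀`. -/
theorem hatQ_eq (z : ℂ) (hz : z ∈ regularSet A 𝓛) (hz₀ : z ∈ resolventPoints B.A₀)
    (hz' : conj z ∈ resolventPoints B.A₀) (u : Cp p) :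
    B.hatQ L z hz u = B.resStar (conj z) hz' (gaugeMap L u) -
      hatP L z hz (adjOfMinus A (gaugeMap L) (B.resReg B.ext₀ (conj z) hz' (gaugeMap L u))) := by
  have h := B.starQ_eq L B.ext₀ z hz hz₀ hz' u
  -- The term 𝐑⁰Lu cancels against the one subtracted in R̂⁰ Lu, leaving the unregularized resolvent
  -- of Lu.
  rw [map_sub, plusToH_resReg, add_sub_assoc', add_sub_cancel] at h
  refine Subtype.ext (Prod.ext h ?_)
  change conj z • hToMinus A (B.starQ L z hz u) + gaugeMap L u =
    gaugeMap L u + conj z • hToMinus A (B.ext₀.resExt (conj z) hz' (gaugeMap L u)) -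
      conj z • hToMinus A (plusToH A (starP L z hz _))
  rw [h, map_sub]
  module

/-- At the base point z̄ all boundary values are explicit: 𝒫̂(z)^⟨*⟩u is a defect vector, and
𝒬̂(z)^⟨*⟩u is a resolvent vector minus a defect vector. -/
theorem hatW_eq_rightResolventMatrix (z₀ : ℂ) (hz₀ : z₀ ∈ resolventPoints B.A₀) (z : ℂ)
    (hz : z ∈ regularSet A 𝓛) (hzA : z ∈ resolventPoints B.A₀) :
    IsUnit (B.pre₁₂ L z hzA) ∧ B.hatW L z₀ hz₀ z hz = B.rightResolventMatrix L z hzA := by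
  have hz' := conj_mem_resolventPoints B.A₀_selfadjoint hzA
  let C : Cp p →ₗ[ℂ] Cp p :=
    LinearMap.fst ℂ (Cp p) (Cp p) ∘ₗ B.extΓ (conj z) hz' ∘ₗ hatP L z hz
  have hP : ∀ u, hatP L z hz u = adjointToStar (B.gammaHat (conj z) hz' (C u)).1 :=
    fun u => B.gammaHat_extΓ (conj z) hz' _ rfl
  have hΓP : ∀ u, B.extΓ (conj z) hz' (hatP L z hz u) = (C u, B.weyl (conj z) hz' (C u)) := by
    intro u
    conv_lhs => rw [hP u, extΓ_adjointToStar, Γ₀_gammaHat, Γ₁_gammaHat]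
  have hΓQ : ∀ u, B.extΓ (conj z) hz' (B.hatQ L z hz u) =
      (0, adjOfPlus A (B.gammaField (conj (conj z)) (conj_mem_resolventPoints B.A₀_selfadjoint hz'))
        (gaugeMap L u)) - (fun c => (C c,
        B.weyl (conj z) hz' (C c)))
          (adjOfMinus A (gaugeMap L) (B.resReg B.ext₀ (conj z) hz' (gaugeMap L u))) := by
    intro u
    rw [B.hatQ_eq L z hz hzA hz' u, map_sub, hΓP, B.extΓ_resStar]
  -- Since γ(z̄)C = 𝒫(z)^⟨*⟩, applying L^⟨*⟩ gives 𝔞₂₁(z̄)C = I, and 𝔞₂₁(z̄) is the adjoint of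
  -- 𝔞₁₂(z).
  have hC : (B.pre₁₂ L z hzA)ᴴ * toEuclideanLin.symm C = 1 := by
    rw [B.pre₁₂_conjTranspose L z hzA _ hz' rfl, pre₂₁, ← toEuclideanLin_symm_comp,
      ← toEuclideanLin_symm_one]
    congr 1
    ext1 u
    have h1 : B.gammaField (conj z) hz' (C u) = starP L z hz u := by
      apply plusToH_injective A
      exact (congrArg (fun x : starRel A => x.1.1) (hP u)).symm
    change adjOfMinus A (gaugeMap L) (B.gammaField (conj z) hz' (C u)) = u
    rw [h1, adjOfMinus_starP]
  have hC' : (toEuclideanLin.symm C : Matrix (Fin p) (Fin p) ℂ)ᴴ * B.pre₁₂ L z hzA = 1 := by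
    rw [← Matrix.conjTranspose_conjTranspose (B.pre₁₂ L z hzA), ← Matrix.conjTranspose_mul, hC,
      Matrix.conjTranspose_one]
  have hinv : (B.pre₁₂ L z hzA)⁻¹ = (toEuclideanLin.symm C : Matrix (Fin p) (Fin p) ℂ)ᴴ :=
    Matrix.inv_eq_left_inv hC'
  refine ⟨IsUnit.of_mul_eq_one_right _ hC', ?_⟩
  -- The blocks of the resolvent matrix at z are rewritten as adjoints of data at z̄, so that both
  -- sides are compared before taking adjoints.
  rw [hatW, B.extΓ_eq_extΓ z₀ hz₀ (conj z) hz', blockMatrix, Matrix.fromBlocks_conjTranspose,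
    rightResolventMatrix, hinv, ← B.pre₁₁_conjTranspose z hzA, ← B.pre₂₂_conjTranspose L z hzA,
    ← B.pre₁₂_conjTranspose L (conj z) hz' z hzA (Complex.conj_conj z).symm]
  simp only [← Matrix.conjTranspose_mul, ← Matrix.conjTranspose_sub, pre₁₁, pre₂₂, pre₁₂,
    ← toEuclideanLin_symm_comp, ← map_sub]
  have hinl : ∀ u, B.hatG L z hz (u, 0) = -B.hatQ L z hz u := fun u => by simp [hatG]
  have hinr : ∀ u, B.hatG L z hz (0, u) = hatP L z hz u := fun u => by simp [hatG]
  -- Before taking adjoints the four blocks are C𝔞₂₂(z̄), M(z̄)C𝔞₂₂(z̄) - 𝔞₁₂(z̄), C and M(z̄)C.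
  congr 1
  · refine congrArg (fun T => (toEuclideanLin.symm T)ᴴ) (LinearMap.ext fun u => ?_)
    simp only [LinearMap.comp_apply, LinearMap.inl_apply, LinearMap.fst_apply,
      ContinuousLinearMap.coe_coe, ContinuousLinearMap.comp_apply]
    rw [hinl, map_neg, hΓQ, Prod.fst_neg, Prod.fst_sub, zero_sub, neg_neg]
  · refine congrArg (fun T => (toEuclideanLin.symm T)ᴴ) (LinearMap.ext fun u => ?_)
    simp only [LinearMap.comp_apply, LinearMap.inl_apply, LinearMap.snd_apply,
      ContinuousLinearMap.coe_coe, ContinuousLinearMap.comp_apply, LinearMap.sub_apply]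
    rw [hinl, map_neg, hΓQ, Prod.snd_neg, Prod.snd_sub, neg_sub]
  · refine congrArg (fun T => (toEuclideanLin.symm T)ᴴ) (LinearMap.ext fun u => ?_)
    change (B.extΓ (conj z) hz' (B.hatG L z hz (0, u))).1 = C u
    rw [hinr]
    rfl
  · refine congrArg (fun T => (toEuclideanLin.symm T)ᴴ) (LinearMap.ext fun u => ?_)
    change (B.extΓ (conj z) hz' (B.hatG L z hz (0, u))).2 = B.weyl (conj z) hz' (C u)
    rw [hinr, hΓP]

end BoundaryTriple

end Gauge

end LResolvent

end

theorem theorem4p8 {H : Type*} [NormedAddCommGroup H] [InnerProductSpace ℂ H] [CompleteSpace H]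
    (A : ClosedSymmetricRelation H) (p : ℕ) (B : BoundaryTriple A p)
    (z₀ : ℂ) (hz₀ : z₀ ∈ resolventPoints B.A₀)
    (𝓛 : Submodule ℂ (HMinus A)) (L : Cp p ≃L[ℂ] 𝓛) (_hne : (regularSet A 𝓛).Nonempty) :
    (∀ (z : ℂ) (hz : z ∈ regularSet A 𝓛) (ζ : ℂ) (hζ : ζ ∈ regularSet A 𝓛),
      (z ≠ conj ζ → B.kernelW L z₀ hz₀ z hz ζ hζ = blockMatrix (B.opG L z hz ∘ₗ B.starG L ζ hζ)) ∧
      Jp p - B.hatW L z₀ hz₀ z hz * Jp p * (B.hatW L z₀ hz₀ ζ hζ)ᴴ =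
        (-Complex.I * (z - conj ζ)) • blockMatrix (B.opG L z hz ∘ₗ B.starG L ζ hζ)) ∧
    ((symRegularSet A 𝓛).Nonempty → ∀ (z : ℂ) (hz : z ∈ symRegularSet A 𝓛),
      IsUnit (B.hatW L z₀ hz₀ z hz.1) ∧
      ∀ hz' : z ∈ resolventPoints B.A₀, IsUnit (B.pre₁₂ L z hz') ∧
        B.hatW L z₀ hz₀ z hz.1 = B.rightResolventMatrix L z hz') := by
  refine ⟨fun z hz ζ hζ => ⟨fun hne => ?_, B.kernel_identity L z₀ hz₀ z hz ζ hζ⟩,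
    fun _ z hz => ⟨B.isUnit_hatW L z₀ hz₀ hz, fun hz' =>
      B.hatW_eq_rightResolventMatrix L z₀ hz₀ z hz.1 hz'⟩⟩
  have hc : -Complex.I * (z - conj ζ) ≠ 0 :=
    mul_ne_zero (neg_ne_zero.mpr Complex.I_ne_zero) (sub_ne_zero.mpr hne)
  rw [BoundaryTriple.kernelW, B.kernel_identity L z₀ hz₀ z hz ζ hζ, inv_smul_smul₀ hc]
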